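/- For $x\in[-1,1]$ let \[ h(x) = x\int_0^{\pi/2}\frac{\cos^2 t}{\sqrt{1-x^2\sin^2 t}}\,dt \] be the real Haagerup function, that is, the restriction to $[-1,1]$ of the complex Haagerup function $H(z)=z\int_0^{\pi/2}\cos^2 t\,(1-|z|^2\sin^2 t)^{-1/2}\,dt$, $|z|\le 1$. Then $h$ is a bijection of $[-1,1]$ onto itself, and its inverse $h^{-1}:[-1,1]\to[-1,1]$ has a power series expansion with real coefficients \[ h^{-1}(x)=\sum_{k=0}^{\infty} b_{2k+1}x^{2k+1} \] valid in some neighborhood of $0$. For every such expansion, $b_{2k+1}\le 0$ for all integers $k\ge 1$. -/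

import Mathlib

open Set Filter Topology

/-- The complex Haagerup function
`H z = z * ∫ t in 0..π/2, cos² t / √(1 - |z|² sin² t)`; it is used for `|z| ≤ 1` only. -/
noncomputable def complexHaagerup (z : ℂ) : ℂ :=
  z * ((∫ t in (0 : ℝ)..(Real.pi / 2),
    Real.cos t ^ 2 / Real.sqrt (1 - ‖z‖ ^ 2 * Real.sin t ^ 2) : ℝ) : ℂ)

/-- The real Haagerup function
`h x = x * ∫ t in 0..π/2, cos² t / √(1 - x² sin² t)`; it is used for `x ∈ [-1, 1]` only. -/
noncomputable def realHaagerup (x : ℝ) : ℝ :=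
  x * ∫ t in (0 : ℝ)..(Real.pi / 2),
    Real.cos t ^ 2 / Real.sqrt (1 - x ^ 2 * Real.sin t ^ 2)

/-- The real Haagerup function is the restriction of the complex one to the reals. -/
theorem ofReal_realHaagerup (x : ℝ) :
    ((realHaagerup x : ℝ) : ℂ) = complexHaagerup (x : ℂ) := by
  simp [realHaagerup, complexHaagerup]

/-- The inverse `h⁻¹ : [-1, 1] → [-1, 1]` of the real Haagerup function; for `y ∈ [-1, 1]` it is the
point `x ∈ [-1, 1]` with `h x = y` (its values for `y ∉ [-1, 1]` are irrelevant). -/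
noncomputable def realHaagerupInv (y : ℝ) : ℝ :=
  Function.invFunOn realHaagerup (Icc (-1) 1) y

/-- `∑ b_{2k+1} x^{2k+1}`, where `b k` stands for the coefficient `b_{2k+1}`, is the power series
expansion of `h⁻¹` in some neighborhood of `0`. -/
def IsHaagerupInvExpansion (b : ℕ → ℝ) : Prop :=
  ∀ᶠ x in 𝓝 (0 : ℝ), HasSum (fun k : ℕ => b k * x ^ (2 * k + 1)) (realHaagerupInv x)

/-! Substitute `x = sin z`. The function `G z = h (sin z)` continues from the real segment to the
strip `|Re z| < π/2` as a holomorphic function, continuous up to the edges and vanishing only at `0`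
(`haagerupLift`). Near `0` one has `h⁻¹ (G z) = sin z`, so the analytic inverse function theorem
gives the expansion, and Cauchy's formula gives its coefficients.

Write `n = 2k + 1`. After integration by parts, `b k` is a contour integral of `cos z / G z ^ n`.
Since `G` is real on the real axis and imaginary on the imaginary axis, a quarter of the contour
suffices: the boundary of `[0, π/2] × [0, Y]`. What remains is `coefficient_eq_im_contour`: up to a
positive factor, `b k` is the imaginary part of an integral over the right edge minus that of one
over the top edge.

On the right edge `G` is expressed by complete elliptic integrals, `G (π/2 + iy) = E(m) + i (K -
E)(1 - m)` with `m = 1 / cosh² y`. Legendre's relation makes the angular derivative of this curve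
equal to `tanh y · C / |G|²` with a constant `C > 0`. With that, an integration by parts against `1
- cos (nφ) ≥ 0` shows that the oscillatory edge integral has a definite sign, with a quantitative
margin of order `1.87⁻ⁿ` (`le_integral_sinh_mul_exp_mul_sin`, `im_integral_edge_le`). On the top
edge with `Y = 4`, `|G| ≥ 3`, so that integral is at most `45 · 3⁻ⁿ` (`norm_integral_top_le`). For
`n ≥ 21` the right edge wins, so `b k ≤ 0` for `k ≥ 10`.

For `k < 10` the coefficients are computed exactly. After rescaling by powers of `π/4` and `16`,
they solve a unitriangular integer system read off from the Taylor polynomial of `h`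
(`haagerupInv_system`), and the signs are inspected. -/

/-! ### Growth of the complex sine along rays; the principal square root. -/

theorem Complex.sq_norm_sin (z : ℂ) :
    ‖Complex.sin z‖ ^ 2 = Real.sin z.re ^ 2 + Real.sinh z.im ^ 2 := by
  have h : Complex.sin z = ((Real.sin z.re * Real.cosh z.im : ℝ) : ℂ)
      + ((Real.cos z.re * Real.sinh z.im : ℝ) : ℂ) * Complex.I := by
    rw [Complex.sin_eq z]; push_cast; ring
  rw [h, ← Complex.normSq_eq_norm_sq, Complex.normSq_add_mul_I, mul_pow, mul_pow, Real.cosh_sq,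
    Real.cos_sq']
  ring

theorem Real.sq_sin_mul_le {a r : ℝ} (ha : |a| ≤ Real.pi / 2) (hr : 0 ≤ r) (hr1 : r ≤ 1) :
    Real.sin (r * a) ^ 2 ≤ Real.sin a ^ 2 := by
  wlog h : 0 ≤ a generalizing a
  · have := this (a := -a) (by rwa [abs_neg]) (by linarith)
    simpa using this
  rw [abs_of_nonneg h] at ha
  have h1 : r * a ≤ a := mul_le_of_le_one_left h hr1
  have h2 : 0 ≤ r * a := mul_nonneg hr h
  have h3 := Real.sin_nonneg_of_nonneg_of_le_pi h2 (by linarith [Real.pi_pos])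
  exact pow_le_pow_left₀ h3 (Real.sin_le_sin_of_le_of_le_pi_div_two (by linarith) ha h1) 2

theorem Real.sq_sin_mul_lt {a r : ℝ} (ha : |a| ≤ Real.pi / 2) (ha0 : a ≠ 0) (hr : 0 ≤ r)
    (hr1 : r < 1) : Real.sin (r * a) ^ 2 < Real.sin a ^ 2 := by
  wlog h : 0 < a generalizing a
  · have := this (a := -a) (by rwa [abs_neg]) (by simpa) (by
      have := lt_of_le_of_ne (not_lt.1 h) ha0; linarith)
    simpa using this
  rw [abs_of_pos h] at ha
  have h1 : r * a < a := mul_lt_of_lt_one_left h hr1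
  have h2 : 0 ≤ r * a := mul_nonneg hr h.le
  have h3 := Real.sin_nonneg_of_nonneg_of_le_pi h2 (by linarith [Real.pi_pos])
  exact pow_lt_pow_left₀ (Real.sin_lt_sin_of_lt_of_le_pi_div_two (by linarith) ha h1) h3 two_ne_zero

theorem Real.sq_sinh_mul_le {a r : ℝ} (hr : 0 ≤ r) (hr1 : r ≤ 1) :
    Real.sinh (r * a) ^ 2 ≤ Real.sinh a ^ 2 := by
  rw [sq_le_sq, Real.abs_sinh, Real.abs_sinh, Real.sinh_le_sinh, abs_mul, abs_of_nonneg hr]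
  exact mul_le_of_le_one_left (abs_nonneg a) hr1

theorem Real.sq_sinh_mul_lt {a r : ℝ} (ha0 : a ≠ 0) (hr : 0 ≤ r) (hr1 : r < 1) :
    Real.sinh (r * a) ^ 2 < Real.sinh a ^ 2 := by
  rw [sq_lt_sq, Real.abs_sinh, Real.abs_sinh, Real.sinh_lt_sinh, abs_mul, abs_of_nonneg hr]
  exact mul_lt_of_lt_one_left (abs_pos.2 ha0) hr1

/-- In `|sin z|² = sin² (Re z) + sinh² (Im z)` both terms grow along rays from `0` inside the closed
strip, and at least one grows strictly. This keeps `1 - (sin (rz) / sin z)²` in the right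
half-plane, away from the branch cut. -/
theorem Complex.norm_sin_mul_lt {z : ℂ} (hz : |z.re| ≤ Real.pi / 2) (hz0 : z ≠ 0) {r : ℝ}
    (hr : 0 ≤ r) (hr1 : r < 1) : ‖Complex.sin (r * z)‖ < ‖Complex.sin z‖ := by
  refine lt_of_pow_lt_pow_left₀ 2 (norm_nonneg _) ?_
  rw [Complex.sq_norm_sin, Complex.sq_norm_sin, Complex.re_ofReal_mul, Complex.im_ofReal_mul]
  by_cases h : z.re = 0
  · have h' : z.im ≠ 0 := fun h' => hz0 (Complex.ext h h')
    exact add_lt_add_of_le_of_lt (Real.sq_sin_mul_le hz hr hr1.le) (Real.sq_sinh_mul_lt h' hr hr1)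
  · exact add_lt_add_of_lt_of_le (Real.sq_sin_mul_lt hz h hr hr1) (Real.sq_sinh_mul_le hr hr1.le)

theorem Complex.sin_ne_zero_of_abs_re_le {z : ℂ} (hz : |z.re| ≤ Real.pi / 2) (hz0 : z ≠ 0) :
    Complex.sin z ≠ 0 := by
  have := Complex.norm_sin_mul_lt hz hz0 le_rfl zero_lt_one
  exact norm_pos_iff.1 ((norm_nonneg _).trans_lt this)

/-! ### The lift of the Haagerup function to the strip. -/

/-- The integrand of `haagerupLift`. -/
noncomputable def haagerupLiftIntegrand (z : ℂ) (r : ℝ) : ℂ :=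
  (1 - (Complex.sin (r * z) / Complex.sin z) ^ 2) ^ (1 / 2 : ℂ)

/-- The lift `z ↦ H (sin z)` of the Haagerup function, continued analytically from the
segment `(0, π/2)` to the strip `|Re z| ≤ π/2`. -/
noncomputable def haagerupLift (z : ℂ) : ℂ :=
  z * ∫ r in (0 : ℝ)..1, haagerupLiftIntegrand z r

theorem Complex.norm_one_sub_sq_mem {q : ℂ} (hq : ‖q‖ < 1) : 0 < (1 - q ^ 2).re := by
  have h : ‖q ^ 2‖ < 1 := by rw [norm_pow]; exact pow_lt_one₀ (norm_nonneg _) hq two_ne_zero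
  have := (Complex.abs_re_le_norm (q ^ 2)).trans_lt h
  rw [abs_lt] at this
  simp only [Complex.sub_re, Complex.one_re]; linarith [this.2]

theorem Complex.norm_cpow_half (w : ℂ) : ‖w ^ (1 / 2 : ℂ)‖ = Real.sqrt ‖w‖ := by
  have := Complex.norm_cpow_real w (1 / 2)
  rw [Real.sqrt_eq_rpow, ← this]; norm_num

theorem Complex.cpow_half_sq (w : ℂ) : (w ^ (1 / 2 : ℂ)) ^ 2 = w := by
  have := Complex.cpow_nat_inv_pow w (n := 2) two_ne_zero
  rw [← this]; simp

theorem Complex.re_cpow_half_nonneg (w : ℂ) : 0 ≤ (w ^ (1 / 2 : ℂ)).re := by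
  by_cases hw : w = 0
  · subst hw; simp
  have h : (1 / 2 : ℂ) = ((1 / 2 : ℝ) : ℂ) := by norm_num
  rw [Complex.cpow_def_of_ne_zero hw, Complex.exp_re, h, mul_comm (Complex.log w),
    Complex.im_ofReal_mul, Complex.log_im]
  refine mul_nonneg (Real.exp_pos _).le (Real.cos_nonneg_of_mem_Icc ⟨?_, ?_⟩)
  · linarith [Complex.neg_pi_lt_arg w]
  · linarith [Complex.arg_le_pi w]

theorem Complex.re_cpow_half_pos {w : ℂ} (hw : 0 < w.re) : 0 < (w ^ (1 / 2 : ℂ)).re := by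
  refine lt_of_le_of_ne (Complex.re_cpow_half_nonneg w) fun h => ?_
  have h2 := congrArg Complex.re (Complex.cpow_half_sq w)
  rw [sq, Complex.mul_re, ← h] at h2
  nlinarith [mul_self_nonneg (w ^ (1 / 2 : ℂ)).im]

/-- With `s` the root, `q = (1 - s)(1 + s)`, and `|1 + s| ≥ 1` because `Re s ≥ 0`. -/
theorem Complex.norm_one_sub_cpow_half_le (q : ℂ) :
    ‖1 - (1 - q) ^ (1 / 2 : ℂ)‖ ≤ ‖q‖ := by
  set s := (1 - q) ^ (1 / 2 : ℂ) with hs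
  have h2 : s ^ 2 = 1 - q := Complex.cpow_half_sq _
  have h3 : q = (1 - s) * (1 + s) := by linear_combination h2
  have h4 : 1 ≤ ‖1 + s‖ := by
    refine le_trans ?_ (Complex.re_le_norm _)
    have := Complex.re_cpow_half_nonneg (1 - q)
    simp only [Complex.add_re, Complex.one_re]; linarith
  rw [h3, norm_mul]
  exact le_mul_of_one_le_right (norm_nonneg _) h4

theorem Complex.ofReal_cpow_half {x : ℝ} (hx : 0 ≤ x) :
    (x : ℂ) ^ (1 / 2 : ℂ) = (Real.sqrt x : ℂ) := by
  rw [Real.sqrt_eq_rpow, Complex.ofReal_cpow hx]; norm_num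

section lift
variable {z : ℂ} {r : ℝ}

theorem norm_sin_mul_div_sin_lt_one (hz : |z.re| ≤ Real.pi / 2) (hz0 : z ≠ 0) (hr : 0 ≤ r)
    (hr1 : r < 1) : ‖Complex.sin (r * z) / Complex.sin z‖ < 1 := by
  rw [norm_div, div_lt_one]
  · exact Complex.norm_sin_mul_lt hz hz0 hr hr1
  · exact norm_pos_iff.2 (Complex.sin_ne_zero_of_abs_re_le hz hz0)

theorem re_haagerupLiftIntegrand_pos (hz : |z.re| ≤ Real.pi / 2) (hz0 : z ≠ 0) (hr : 0 ≤ r)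
    (hr1 : r < 1) : 0 < (haagerupLiftIntegrand z r).re :=
  Complex.re_cpow_half_pos
    (Complex.norm_one_sub_sq_mem (norm_sin_mul_div_sin_lt_one hz hz0 hr hr1))

theorem norm_haagerupLiftIntegrand_le (hz : |z.re| ≤ Real.pi / 2) (hr : 0 ≤ r)
    (hr1 : r < 1) : ‖haagerupLiftIntegrand z r‖ ≤ 2 := by
  by_cases hz0 : z = 0
  · subst hz0; simp [haagerupLiftIntegrand]
  rw [haagerupLiftIntegrand, Complex.norm_cpow_half]
  refine Real.sqrt_le_iff.2 ⟨by norm_num, ?_⟩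
  have h := norm_sin_mul_div_sin_lt_one hz hz0 hr hr1
  refine (norm_sub_le _ _).trans ?_
  rw [norm_pow, norm_one]
  have := pow_le_one₀ (n := 2) (norm_nonneg _) h.le
  linarith

theorem differentiableAt_haagerupLiftIntegrand (hz : |z.re| ≤ Real.pi / 2) (hz0 : z ≠ 0)
    (hr : 0 ≤ r) (hr1 : r < 1) :
    DifferentiableAt ℂ (fun z => haagerupLiftIntegrand z r) z := by
  unfold haagerupLiftIntegrand
  have h : 1 - (Complex.sin (r * z) / Complex.sin z) ^ 2 ∈ Complex.slitPlane := Or.inl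
    (Complex.norm_one_sub_sq_mem (norm_sin_mul_div_sin_lt_one hz hz0 hr hr1))
  have hs := Complex.sin_ne_zero_of_abs_re_le hz hz0
  refine DifferentiableAt.cpow ?_ (differentiableAt_const _) h
  refine (differentiableAt_const _).sub (DifferentiableAt.pow (DifferentiableAt.div ?_ ?_ hs) 2)
  · exact (differentiableAt_id.const_mul _).csin
  · exact differentiableAt_id.csin

theorem measurable_haagerupLiftIntegrand (z : ℂ) : Measurable (haagerupLiftIntegrand z) := by
  unfold haagerupLiftIntegrand
  refine Measurable.pow_const ?_ _
  have : Continuous fun r : ℝ => 1 - (Complex.sin (r * z) / Complex.sin z) ^ 2 := by fun_prop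
  exact this.measurable

/-- At `r = 1` the sine quotient equals `1` and the strict estimates fail; this discards that
endpoint as a null set. -/
theorem ae_mem_uIoc_zero_one_imp_lt {p : ℝ → Prop} (h : ∀ r, 0 ≤ r → r < 1 → p r) :
    ∀ᵐ r : ℝ, r ∈ Set.uIoc (0 : ℝ) 1 → p r := by
  have h1 : ∀ᵐ r : ℝ, r ≠ 1 := by simp [MeasureTheory.ae_iff]
  filter_upwards [h1] with r hr hm
  rw [Set.uIoc_of_le zero_le_one] at hm
  exact h r hm.1.le (lt_of_le_of_ne hm.2 hr)

theorem intervalIntegrable_haagerupLiftIntegrand (hz : |z.re| ≤ Real.pi / 2) :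
    IntervalIntegrable (haagerupLiftIntegrand z) MeasureTheory.volume 0 1 := by
  refine IntervalIntegrable.mono_fun' (g := fun _ => (2 : ℝ)) intervalIntegrable_const
    (measurable_haagerupLiftIntegrand z).aestronglyMeasurable ?_
  exact (MeasureTheory.ae_restrict_iff' measurableSet_uIoc).2
    (ae_mem_uIoc_zero_one_imp_lt fun r h h1 => norm_haagerupLiftIntegrand_le hz h h1)

theorem norm_haagerupLift_le (hz : |z.re| ≤ Real.pi / 2) : ‖haagerupLift z‖ ≤ 2 * ‖z‖ := by
  rw [haagerupLift, norm_mul, mul_comm]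
  refine mul_le_mul_of_nonneg_right ?_ (norm_nonneg z)
  have := intervalIntegral.norm_integral_le_of_norm_le_const_ae (a := (0 : ℝ)) (b := 1) (C := 2)
    (f := haagerupLiftIntegrand z)
    (ae_mem_uIoc_zero_one_imp_lt fun r h h1 => norm_haagerupLiftIntegrand_le hz h h1)
  simpa using this

@[simp] theorem haagerupLift_zero : haagerupLift 0 = 0 := by simp [haagerupLift]

theorem isOpen_abs_re_lt : IsOpen {z : ℂ | |z.re| < Real.pi / 2} :=
  isOpen_lt (by fun_prop) continuous_const

theorem continuousOn_haagerupLift : ContinuousOn haagerupLift {z : ℂ | |z.re| ≤ Real.pi / 2} := by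
  intro z hz
  by_cases hz0 : z = 0
  -- At `z = 0` the convention `0 / 0 = 0` makes the integrand `1`, which is not its limit; the
  -- bounded integral is multiplied by `z`, so this is harmless.
  · subst hz0
    rw [ContinuousWithinAt, haagerupLift_zero]
    refine squeeze_zero_norm' (a := fun z : ℂ => 2 * ‖z‖) ?_ ?_
    · filter_upwards [self_mem_nhdsWithin] with w hw using norm_haagerupLift_le hw
    · have : Continuous fun z : ℂ => 2 * ‖z‖ := by fun_prop
      simpa using (this.tendsto 0).mono_left nhdsWithin_le_nhds
  refine continuousWithinAt_id.mul ?_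
  refine intervalIntegral.continuousWithinAt_of_dominated_interval (bound := fun _ => (2 : ℝ))
    ?_ ?_ intervalIntegrable_const ?_
  · exact Eventually.of_forall fun w => (measurable_haagerupLiftIntegrand w).aestronglyMeasurable
  · filter_upwards [self_mem_nhdsWithin] with w hw
    exact ae_mem_uIoc_zero_one_imp_lt fun r h h1 => norm_haagerupLiftIntegrand_le hw h h1
  · exact ae_mem_uIoc_zero_one_imp_lt fun r h h1 =>
      (differentiableAt_haagerupLiftIntegrand hz hz0 h h1).continuousAt.continuousWithinAt

/-- Away from `0` one differentiates under the integral sign; at `0` the singularity is removable by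
continuity. -/
theorem differentiableAt_haagerupLift (hz : |z.re| < Real.pi / 2) :
    DifferentiableAt ℂ haagerupLift z := by
  suffices H : ∀ z : ℂ, |z.re| < Real.pi / 2 → z ≠ 0 → DifferentiableAt ℂ haagerupLift z by
    by_cases hz0 : z = 0
    · subst hz0
      refine (Complex.analyticAt_of_differentiable_on_punctured_nhds_of_continuousAt ?_
        (continuousOn_haagerupLift.continuousAt ?_)).differentiableAt
      · filter_upwards [self_mem_nhdsWithin, nhdsWithin_le_nhds (isOpen_abs_re_lt.mem_nhds hz)]
          with w hw hw' using H w hw' hw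
      · filter_upwards [isOpen_abs_re_lt.mem_nhds hz] with w hw using le_of_lt hw
    · exact H z hz hz0
  intro z hz hz0
  obtain ⟨ε, hε, hball⟩ := Metric.isOpen_iff.1 (isOpen_abs_re_lt.inter isOpen_ne) z ⟨hz, hz0⟩
  refine differentiableAt_id.mul ?_
  refine (intervalIntegral.hasDerivAt_integral_of_dominated_loc_of_deriv_le
    (s := Metric.ball z (ε / 2)) (F' := fun w r => deriv (fun w => haagerupLiftIntegrand w r) w)
    (bound := fun _ => 2 / (ε / 2)) (Metric.ball_mem_nhds z (by positivity)) ?_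
    (intervalIntegrable_haagerupLiftIntegrand hz.le) ?_ ?_ intervalIntegrable_const ?_
    ).2.differentiableAt
  · exact Eventually.of_forall fun w => (measurable_haagerupLiftIntegrand w).aestronglyMeasurable
  -- The derivative is written out only to see that it is measurable in `r`.
  · refine AEMeasurable.aestronglyMeasurable (AEMeasurable.congr (f := fun r : ℝ =>
      (1 / 2 : ℂ) * (1 - (Complex.sin (r * z) / Complex.sin z) ^ 2) ^ ((1 / 2 : ℂ) - 1) *
        -(((2 : ℕ) : ℂ) * (Complex.sin (r * z) / Complex.sin z) ^ (2 - 1) *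
          ((Complex.cos (r * z) * (r * 1) * Complex.sin z - Complex.sin (r * z) * Complex.cos z) /
            Complex.sin z ^ 2))) ?_ ?_)
    · refine Measurable.aemeasurable (((Measurable.pow_const ?_ _).const_mul _).mul ?_)
      · have : Continuous fun r : ℝ => 1 - (Complex.sin (r * z) / Complex.sin z) ^ 2 := by fun_prop
        exact this.measurable
      · refine Continuous.measurable ?_
        fun_prop
    · refine (MeasureTheory.ae_restrict_iff' measurableSet_uIoc).2
        (ae_mem_uIoc_zero_one_imp_lt fun r h h1 => ?_)
      have hs := Complex.sin_ne_zero_of_abs_re_le hz.le hz0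
      have hsl : 1 - (Complex.sin (r * z) / Complex.sin z) ^ 2 ∈ Complex.slitPlane := Or.inl
        (Complex.norm_one_sub_sq_mem (norm_sin_mul_div_sin_lt_one hz.le hz0 h h1))
      have hd1 : HasDerivAt (fun w => Complex.sin (r * w)) (Complex.cos (r * z) * (r * 1)) z :=
        ((hasDerivAt_id z).const_mul (r : ℂ)).csin
      exact ((((hd1.div (Complex.hasDerivAt_sin z) hs).pow 2).const_sub 1).cpow_const
        hsl).deriv.symm
  · refine ae_mem_uIoc_zero_one_imp_lt fun r h h1 w hw => ?_
    have hsub : ∀ v ∈ Metric.closedBall w (ε / 2), |v.re| < Real.pi / 2 ∧ v ≠ 0 := fun v hv => by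
      refine hball ?_
      rw [Metric.mem_ball] at hw ⊢; rw [Metric.mem_closedBall] at hv
      linarith [dist_triangle v w z]
    -- Cauchy's estimate on a disc of radius `ε / 2` turns the uniform bound `2` on the integrand
    -- into one on its derivative, so no singularity at `r = 1` has to be controlled.
    refine Complex.norm_deriv_le_of_forall_mem_sphere_norm_le (by positivity) ?_ ?_
    · refine DifferentiableOn.diffContOnCl fun v hv => ?_
      rw [closure_ball _ (by positivity)] at hv
      exact (differentiableAt_haagerupLiftIntegrand (hsub v hv).1.le (hsub v hv).2 h
        h1).differentiableWithinAt
    · intro v hv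
      exact norm_haagerupLiftIntegrand_le (hsub v (Metric.sphere_subset_closedBall hv)).1.le h h1
  · refine ae_mem_uIoc_zero_one_imp_lt fun r h h1 w hw => ?_
    have : |w.re| < Real.pi / 2 ∧ w ≠ 0 := hball (Metric.ball_subset_ball (by linarith) hw)
    exact (differentiableAt_haagerupLiftIntegrand this.1.le this.2 h h1).hasDerivAt

theorem re_integral_haagerupLiftIntegrand_pos (hz : |z.re| ≤ Real.pi / 2) (hz0 : z ≠ 0) :
    0 < (∫ r in (0 : ℝ)..1, haagerupLiftIntegrand z r).re := by
  have hi := intervalIntegrable_haagerupLiftIntegrand hz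
  have h1 : (∫ r in (0 : ℝ)..1, haagerupLiftIntegrand z r).re
      = ∫ r in (0 : ℝ)..1, (haagerupLiftIntegrand z r).re :=
    (Complex.reCLM.intervalIntegral_comp_comm hi).symm
  rw [h1]
  refine intervalIntegral.intervalIntegral_pos_of_pos_on ?_
    (fun r hr => re_haagerupLiftIntegrand_pos hz hz0 hr.1.le hr.2) zero_lt_one
  exact ⟨hi.1.re, hi.2.re⟩

theorem haagerupLift_ne_zero (hz : |z.re| ≤ Real.pi / 2) (hz0 : z ≠ 0) : haagerupLift z ≠ 0 := by
  refine mul_ne_zero hz0 fun h => ?_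
  have := re_integral_haagerupLiftIntegrand_pos hz hz0
  rw [h] at this; exact lt_irrefl _ this

/-- The lift is `z` times a number of positive real part; with `Re z ≥ 0` the arguments add up to
less than `π` in absolute value. Hence `log ∘ haagerupLift` is available on the whole right half of
the strip. -/
theorem haagerupLift_mem_slitPlane (hz : |z.re| ≤ Real.pi / 2) (hz0 : z ≠ 0) (hre : 0 ≤ z.re) :
    haagerupLift z ∈ Complex.slitPlane := by
  by_contra h
  rw [Complex.mem_slitPlane_iff, not_or, not_lt, not_not] at h
  have hp := re_integral_haagerupLiftIntegrand_pos hz hz0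
  set w := ∫ r in (0 : ℝ)..1, haagerupLiftIntegrand z r with hw
  have hG : haagerupLift z = z * w := rfl
  rw [hG, Complex.mul_re, Complex.mul_im] at h
  obtain ⟨ha, hb⟩ := h
  have key : w.re * Complex.normSq z
      = z.re * (z.re * w.re - z.im * w.im) + z.im * (z.re * w.im + z.im * w.re) := by
    rw [Complex.normSq_apply]; ring
  rw [hb] at key
  have : 0 < w.re * Complex.normSq z := mul_pos hp (Complex.normSq_pos.2 hz0)
  nlinarith

end lift

/-! ### Values of the lift on the two axes. -/

theorem haagerupLift_neg (z : ℂ) : haagerupLift (-z) = -haagerupLift z := by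
  simp [haagerupLift, haagerupLiftIntegrand]

theorem haagerupLift_ofReal {s : ℝ} (hs : |s| ≤ Real.pi / 2) :
    haagerupLift s
      = ((s * ∫ r in (0 : ℝ)..1, Real.sqrt (1 - (Real.sin (r * s) / Real.sin s) ^ 2) : ℝ) : ℂ) := by
  rw [haagerupLift, Complex.ofReal_mul, ← intervalIntegral.integral_ofReal]
  congr 1
  refine intervalIntegral.integral_congr fun r hr => ?_
  rw [uIcc_of_le zero_le_one] at hr
  have h : 0 ≤ 1 - (Real.sin (r * s) / Real.sin s) ^ 2 := by
    rw [div_pow, sub_nonneg]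
    exact div_le_one_of_le₀ (Real.sq_sin_mul_le hs hr.1 hr.2) (sq_nonneg _)
  simp only [haagerupLiftIntegrand]
  rw [← Complex.ofReal_cpow_half h]
  push_cast; rfl

theorem haagerupLift_mul_I (s : ℝ) :
    haagerupLift (s * Complex.I)
      = ((s * ∫ r in (0 : ℝ)..1, Real.sqrt (1 - (Real.sinh (r * s) / Real.sinh s) ^ 2) : ℝ) : ℂ)
        * Complex.I := by
  rw [haagerupLift, Complex.ofReal_mul, ← intervalIntegral.integral_ofReal, mul_right_comm]
  congr 2
  refine intervalIntegral.integral_congr fun r hr => ?_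
  rw [uIcc_of_le zero_le_one] at hr
  have h : 0 ≤ 1 - (Real.sinh (r * s) / Real.sinh s) ^ 2 := by
    rw [div_pow, sub_nonneg]
    exact div_le_one_of_le₀ (Real.sq_sinh_mul_le hr.1 hr.2) (sq_nonneg _)
  simp only [haagerupLiftIntegrand]
  rw [← Complex.ofReal_cpow_half h, ← mul_assoc, Complex.sin_mul_I, ← Complex.ofReal_mul,
    Complex.sin_mul_I, mul_div_mul_right _ _ Complex.I_ne_zero]
  push_cast; rfl

/-- With `x = sin s`, substitute `w = r s` and then `sin w = x sin t`. -/
theorem haagerupLift_ofReal_eq_realHaagerup {s : ℝ} (hs : 0 < s) (hs' : s < Real.pi / 2) :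
    haagerupLift s = realHaagerup (Real.sin s) := by
  rw [haagerupLift_ofReal (by rw [abs_of_pos hs]; exact hs'.le)]
  congr 1
  have hx0 : 0 < Real.sin s := Real.sin_pos_of_pos_of_lt_pi hs (by linarith)
  have hx1 : Real.sin s < 1 := by
    rw [← Real.sin_pi_div_two]
    exact Real.sin_lt_sin_of_lt_of_le_pi_div_two (by linarith) le_rfl hs'
  set x := Real.sin s with hx
  have h1 := intervalIntegral.mul_integral_comp_mul_right (a := 0) (b := 1)
    (f := fun w => Real.sqrt (1 - (Real.sin w / x) ^ 2)) s
  simp only [zero_mul, one_mul] at h1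
  rw [h1]
  have hlt : ∀ t : ℝ, |x * Real.sin t| < 1 := fun t => by
    rw [abs_mul, abs_of_pos hx0]
    have := Real.abs_sin_le_one t
    nlinarith [abs_nonneg (Real.sin t)]
  have hpos : ∀ t : ℝ, 0 < 1 - (x * Real.sin t) ^ 2 := fun t => by
    have := (sq_lt_one_iff_abs_lt_one _).2 (hlt t); linarith
  have hsub := intervalIntegral.integral_comp_mul_deriv (a := 0) (b := Real.pi / 2)
    (f := fun t => Real.arcsin (x * Real.sin t))
    (f' := fun t => 1 / Real.sqrt (1 - (x * Real.sin t) ^ 2) * (x * Real.cos t))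
    (g := fun w => Real.sqrt (1 - (Real.sin w / x) ^ 2)) ?_ ?_ (by fun_prop)
  · simp only [Real.sin_zero, mul_zero, Real.arcsin_zero, Real.sin_pi_div_two, mul_one] at hsub
    rw [hx, Real.arcsin_sin (by linarith) hs'.le, ← hx] at hsub
    rw [← hsub, realHaagerup, ← intervalIntegral.integral_const_mul]
    refine intervalIntegral.integral_congr fun t ht => ?_
    rw [uIcc_of_le (by positivity)] at ht
    have hc : 0 ≤ Real.cos t := Real.cos_nonneg_of_mem_Icc ⟨by linarith [ht.1, Real.pi_pos], ht.2⟩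
    simp only [Function.comp]
    rw [Real.sin_arcsin (by linarith [(abs_lt.1 (hlt t)).1]) (by linarith [(abs_lt.1 (hlt t)).2]),
      mul_div_cancel_left₀ _ hx0.ne', ← Real.cos_sq', Real.sqrt_sq hc, mul_pow]
    ring
  · intro t _
    have h := (abs_lt.1 (hlt t))
    exact (Real.hasDerivAt_arcsin h.1.ne' h.2.ne).comp t ((Real.hasDerivAt_sin t).const_mul x)
  · refine ContinuousOn.mul (ContinuousOn.div continuousOn_const (by fun_prop) fun t _ => ?_)
      (by fun_prop)
    exact (Real.sqrt_pos.2 (hpos t)).ne'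

/-! ### The lift on the right edge of the strip. -/

theorem Complex.norm_sin_le_cosh_im (z : ℂ) : ‖Complex.sin z‖ ≤ Real.cosh z.im := by
  refine le_of_sq_le_sq ?_ (Real.cosh_pos _).le
  rw [Complex.sq_norm_sin, Real.cosh_sq]
  linarith [Real.sin_sq_le_one z.re]

theorem Complex.sin_pi_div_two_add_mul_I (s : ℝ) :
    Complex.sin ((Real.pi / 2 : ℝ) + s * Complex.I) = Real.cosh s := by
  rw [add_comm]; push_cast
  rw [Complex.sin_add_pi_div_two, Complex.cos_mul_I]

theorem Complex.cos_pi_div_two_add_mul_I (s : ℝ) :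
    Complex.cos ((Real.pi / 2 : ℝ) + s * Complex.I) = -(Real.sinh s * Complex.I) := by
  rw [add_comm]; push_cast
  rw [Complex.cos_add_pi_div_two, Complex.sin_mul_I]

/-- At this point `sin z = cosh y` is real, so the lift is the integral of `√(1 - (sin w / cosh
y)²)` along the straight path from `0` to `z`. The integrand is holomorphic for `|Im w| < y`, so the
path deforms to `0 → π/2 → π/2 + iy`. The endpoint lies on the boundary of that region, hence the
passage to the limit from heights `s < y`. -/
theorem haagerupLift_pi_div_two_add_mul_I {y : ℝ} (hy : 0 < y) :
    haagerupLift ((Real.pi / 2 : ℝ) + y * Complex.I)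
      = ((∫ t in (0 : ℝ)..(Real.pi / 2), Real.sqrt (1 - (Real.sin t / Real.cosh y) ^ 2) : ℝ) : ℂ)
        + ((∫ s in (0 : ℝ)..y, Real.sqrt (1 - (Real.cosh s / Real.cosh y) ^ 2) : ℝ) : ℂ)
          * Complex.I := by
  set f : ℂ → ℂ := fun w => (1 - (Complex.sin w / Real.cosh y) ^ 2) ^ (1 / 2 : ℂ) with hf
  set U : Set ℂ := {w | |w.im| < y} with hU
  have hUo : IsOpen U := isOpen_lt (by fun_prop) continuous_const
  have hUc : Convex ℝ U := by
    have : U = Complex.imLm ⁻¹' (Ioo (-y) y) := by ext w; simp [hU, abs_lt]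
    rw [this]; exact (convex_Ioo _ _).linear_preimage _
  have hq : ∀ w : ℂ, |w.im| < y → ‖Complex.sin w / Real.cosh y‖ < 1 := fun w hw => by
    rw [norm_div, div_lt_one (norm_pos_iff.2 (Complex.ofReal_ne_zero.2 (Real.cosh_pos y).ne')), Complex.norm_real,
      Real.norm_of_nonneg (Real.cosh_pos y).le]
    refine (Complex.norm_sin_le_cosh_im w).trans_lt (Real.cosh_lt_cosh.2 ?_)
    rwa [abs_of_pos hy]
  have hfd : ∀ w ∈ U, DifferentiableAt ℂ f w := fun w hw => by
    refine DifferentiableAt.cpow (by fun_prop) (by fun_prop)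
      (Or.inl (Complex.norm_one_sub_sq_mem (hq w hw)))
  obtain ⟨P, hP⟩ := hUc.exists_forall_hasDerivWithinAt fun w hw => (hfd w hw).differentiableWithinAt
  replace hP : ∀ w ∈ U, HasDerivAt P (f w) w := fun w hw => (hP w hw).hasDerivAt (hUo.mem_nhds hw)
  have hfc : ContinuousOn f U := fun w hw => (hfd w hw).continuousAt.continuousWithinAt
  -- the fundamental theorem of calculus along the real and vertical segments
  have seg : ∀ (a b : ℂ) (p q : ℝ), (∀ t ∈ uIcc p q, a + t * b ∈ U) →
      ∫ t in p..q, f (a + t * b) * b = P (a + q * b) - P (a + p * b) := by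
    intro a b p q hab
    refine intervalIntegral.integral_eq_sub_of_hasDerivAt (f := fun t : ℝ => P (a + t * b))
      (fun t ht => ?_) ?_
    · have h1 : HasDerivAt (fun t : ℝ => a + (t : ℂ) * b) b t := by
        simpa using ((Complex.ofRealCLM.hasDerivAt (x := t)).mul_const b).const_add a
      exact (hP _ (hab t ht)).comp t h1
    · refine ContinuousOn.intervalIntegrable (ContinuousOn.mul ?_ continuousOn_const)
      exact hfc.comp (by fun_prop) hab
  have hreal : ∀ t : ℝ, f t = ((Real.sqrt (1 - (Real.sin t / Real.cosh y) ^ 2) : ℝ) : ℂ) := by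
    intro t
    have h : 0 ≤ 1 - (Real.sin t / Real.cosh y) ^ 2 := by
      rw [div_pow, sub_nonneg]
      refine div_le_one_of_le₀ ((Real.sin_sq_le_one t).trans ?_) (sq_nonneg _)
      exact one_le_pow₀ (Real.one_le_cosh y)
    rw [← Complex.ofReal_cpow_half h, hf]; push_cast; rfl
  have hvert : ∀ s : ℝ, 0 ≤ s → s ≤ y → f ((Real.pi / 2 : ℝ) + s * Complex.I)
      = ((Real.sqrt (1 - (Real.cosh s / Real.cosh y) ^ 2) : ℝ) : ℂ) := by
    intro s hs hsy
    have h : 0 ≤ 1 - (Real.cosh s / Real.cosh y) ^ 2 := by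
      rw [sub_nonneg]
      refine pow_le_one₀ (div_nonneg (Real.cosh_pos s).le (Real.cosh_pos y).le) ?_
      refine div_le_one_of_le₀ (Real.cosh_le_cosh.2 ?_) (Real.cosh_pos y).le
      rwa [abs_of_nonneg hs, abs_of_pos hy]
    rw [← Complex.ofReal_cpow_half h, hf]
    simp only [Complex.sin_pi_div_two_add_mul_I]; push_cast; rfl
  set ζ : ℝ → ℂ := fun s => (Real.pi / 2 : ℝ) + s * Complex.I with hζ
  have hζim : ∀ (r s : ℝ), ((r : ℂ) * ζ s).im = r * s := fun r s => by
    rw [Complex.im_ofReal_mul]; simp [hζ]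
  have main : ∀ s ∈ Ioo 0 y, ∫ r in (0 : ℝ)..1, f (r * ζ s) * ζ s
      = ((∫ t in (0 : ℝ)..(Real.pi / 2), Real.sqrt (1 - (Real.sin t / Real.cosh y) ^ 2) : ℝ) : ℂ)
        + ((∫ u in (0 : ℝ)..s, Real.sqrt (1 - (Real.cosh u / Real.cosh y) ^ 2) : ℝ) : ℂ)
          * Complex.I := by
    intro s hs
    have h1 := seg 0 (ζ s) 0 1 fun t ht => by
      rw [uIcc_of_le zero_le_one] at ht
      rw [zero_add, hU, mem_ofPred_eq, hζim, abs_of_nonneg (mul_nonneg ht.1 hs.1.le)]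
      nlinarith [hs.1, hs.2, ht.1, ht.2]
    have h2 := seg 0 1 0 (Real.pi / 2) fun t ht => by simpa [hU] using hy
    have h3 := seg (Real.pi / 2 : ℝ) Complex.I 0 s fun t ht => by
      rw [uIcc_of_le hs.1.le] at ht
      rw [hU, mem_ofPred_eq]
      simp only [Complex.add_im, Complex.ofReal_im, Complex.im_ofReal_mul, Complex.I_im, mul_one,
        zero_add, abs_of_nonneg ht.1]
      exact ht.2.trans_lt hs.2
    simp only [zero_add, mul_one, Complex.ofReal_zero, zero_mul, Complex.ofReal_one, one_mul,
      add_zero] at h1 h2 h3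
    rw [h1, ← intervalIntegral.integral_ofReal, ← intervalIntegral.integral_ofReal,
      ← intervalIntegral.integral_mul_const]
    have e2 : ∫ t in (0 : ℝ)..(Real.pi / 2),
        ((Real.sqrt (1 - (Real.sin t / Real.cosh y) ^ 2) : ℝ) : ℂ) = P (Real.pi / 2 : ℝ) - P 0 := by
      rw [← h2]; exact intervalIntegral.integral_congr fun t _ => (hreal t).symm
    have e3 : ∫ t in (0 : ℝ)..s,
        ((Real.sqrt (1 - (Real.cosh t / Real.cosh y) ^ 2) : ℝ) : ℂ) * Complex.I
          = P (ζ s) - P (Real.pi / 2 : ℝ) := by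
      rw [← h3]
      refine intervalIntegral.integral_congr fun t ht => ?_
      rw [uIcc_of_le hs.1.le] at ht
      exact congrArg (· * Complex.I) (hvert t ht.1 (ht.2.trans hs.2.le)).symm
    rw [e2, e3]; ring
  have hev : Ioo 0 y ∈ 𝓝[<] y := Ioo_mem_nhdsLT hy
  have hlim1 : Tendsto (fun s => ∫ r in (0 : ℝ)..1, f (r * ζ s) * ζ s) (𝓝[<] y)
      (𝓝 (∫ r in (0 : ℝ)..1, f (r * ζ y) * ζ y)) := by
    have hζc : Continuous ζ := by fun_prop
    obtain ⟨M, hM⟩ := (isCompact_Icc (a := (0 : ℝ)) (b := y)).exists_bound_of_continuousOn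
      hζc.continuousOn
    refine intervalIntegral.tendsto_integral_filter_of_dominated_convergence (fun _ => 2 * M)
      ?_ ?_ intervalIntegrable_const ?_
    · refine Eventually.of_forall fun s => Measurable.aestronglyMeasurable ?_
      refine Measurable.mul_const ?_ _
      have : Continuous fun r : ℝ => 1 - (Complex.sin (r * ζ s) / Real.cosh y) ^ 2 := by fun_prop
      exact this.measurable.pow_const _
    · filter_upwards [hev] with s hs
      refine ae_mem_uIoc_zero_one_imp_lt fun r h h1 => ?_
      rw [norm_mul]
      refine mul_le_mul ?_ (hM s ⟨hs.1.le, hs.2.le⟩) (norm_nonneg _) zero_le_two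
      have hq' := hq (r * ζ s) (by
        rw [hζim, abs_of_nonneg (mul_nonneg h hs.1.le)]
        nlinarith [hs.1, hs.2])
      rw [hf, Complex.norm_cpow_half]
      refine Real.sqrt_le_iff.2 ⟨by norm_num, (norm_sub_le _ _).trans ?_⟩
      rw [norm_pow, norm_one]
      have := pow_le_one₀ (n := 2) (norm_nonneg _) hq'.le
      linarith
    · refine ae_mem_uIoc_zero_one_imp_lt fun r h h1 => ?_
      have hmem : (r : ℂ) * ζ y ∈ U := by
        rw [hU, mem_ofPred_eq, hζim, abs_of_nonneg (mul_nonneg h hy.le)]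
        nlinarith
      have hc : ContinuousAt (fun s : ℝ => f (r * ζ s) * ζ s) y := by
        refine ContinuousAt.mul ?_ hζc.continuousAt
        exact ContinuousAt.comp (f := fun s : ℝ => (r : ℂ) * ζ s) (hfd _ hmem).continuousAt
          (by fun_prop)
      exact hc.tendsto.mono_left nhdsWithin_le_nhds
  have hlim2 : Tendsto (fun s =>
      ((∫ t in (0 : ℝ)..(Real.pi / 2), Real.sqrt (1 - (Real.sin t / Real.cosh y) ^ 2) : ℝ) : ℂ)
        + ((∫ u in (0 : ℝ)..s, Real.sqrt (1 - (Real.cosh u / Real.cosh y) ^ 2) : ℝ) : ℂ)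
          * Complex.I) (𝓝[<] y) (𝓝 (
      ((∫ t in (0 : ℝ)..(Real.pi / 2), Real.sqrt (1 - (Real.sin t / Real.cosh y) ^ 2) : ℝ) : ℂ)
        + ((∫ u in (0 : ℝ)..y, Real.sqrt (1 - (Real.cosh u / Real.cosh y) ^ 2) : ℝ) : ℂ)
          * Complex.I)) := by
    have hc : Continuous fun s : ℝ =>
        ∫ u in (0 : ℝ)..s, Real.sqrt (1 - (Real.cosh u / Real.cosh y) ^ 2) :=
      intervalIntegral.continuous_primitive
        (fun a b => Continuous.intervalIntegrable (by fun_prop) a b) 0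
    have hc' : Continuous fun s : ℝ =>
      ((∫ t in (0 : ℝ)..(Real.pi / 2), Real.sqrt (1 - (Real.sin t / Real.cosh y) ^ 2) : ℝ) : ℂ)
        + ((∫ u in (0 : ℝ)..s, Real.sqrt (1 - (Real.cosh u / Real.cosh y) ^ 2) : ℝ) : ℂ)
          * Complex.I :=
      continuous_const.add ((Complex.continuous_ofReal.comp hc).mul continuous_const)
    exact (hc'.tendsto y).mono_left nhdsWithin_le_nhds
  have heq := tendsto_nhds_unique (hlim1.congr' (by filter_upwards [hev] with s hs using main s hs))
    hlim2
  rw [← heq, haagerupLift, mul_comm, ← intervalIntegral.integral_mul_const]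
  refine intervalIntegral.integral_congr (E := ℂ) fun r _ => ?_
  simp only [haagerupLiftIntegrand, hf, hζ, Complex.sin_pi_div_two_add_mul_I]

/-! ### Complete elliptic integrals and Legendre's relation. -/

/-- The complete elliptic integral of the second kind, `∫ √(1 - m sin² t)` over `[0, π/2]`,
as a function of the parameter `m`. -/
noncomputable def ellipticE (m : ℝ) : ℝ :=
  ∫ t in (0 : ℝ)..(Real.pi / 2), Real.sqrt (1 - m * Real.sin t ^ 2)

/-- The difference `K - E` of the complete elliptic integrals of the first and second kinds,
as a function of the parameter `m`. -/
noncomputable def ellipticKSubE (m : ℝ) : ℝ :=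
  ∫ t in (0 : ℝ)..(Real.pi / 2), m * Real.sin t ^ 2 / Real.sqrt (1 - m * Real.sin t ^ 2)

section elliptic
variable {m : ℝ}

theorem one_sub_mul_sin_sq_ge {m d : ℝ} (hd : d ≤ 1) (h : m ≤ 1 - d) (t : ℝ) :
    d ≤ 1 - m * Real.sin t ^ 2 := by
  have h1 := Real.sin_sq_le_one t
  have h2 := sq_nonneg (Real.sin t)
  nlinarith

theorem one_sub_mul_sin_sq_pos (h : m < 1) (t : ℝ) : 0 < 1 - m * Real.sin t ^ 2 := by
  have := one_sub_mul_sin_sq_ge (m := m) (d := min 1 (1 - m)) (min_le_left _ _)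
    (by linarith [min_le_right 1 (1 - m)]) t
  exact lt_of_lt_of_le (lt_min one_pos (by linarith)) this

theorem continuous_ellipticKSubE_integrand (h : m < 1) :
    Continuous fun t => m * Real.sin t ^ 2 / Real.sqrt (1 - m * Real.sin t ^ 2) := by
  refine Continuous.div (by fun_prop) (by fun_prop) fun t => ?_
  exact (Real.sqrt_pos.2 (one_sub_mul_sin_sq_pos h t)).ne'

theorem hasDerivAt_ellipticE (h0 : 0 < m) (h1 : m < 1) :
    HasDerivAt ellipticE (-(ellipticKSubE m / (2 * m))) m := by
  set d := (1 - m) / 2 with hd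
  have hd0 : 0 < d := by rw [hd]; linarith
  have key := intervalIntegral.hasDerivAt_integral_of_dominated_loc_of_deriv_le
    (μ := MeasureTheory.volume) (a := 0) (b := Real.pi / 2) (x₀ := m)
    (F := fun m t => Real.sqrt (1 - m * Real.sin t ^ 2))
    (F' := fun m t => -(Real.sin t ^ 2) / (2 * Real.sqrt (1 - m * Real.sin t ^ 2)))
    (bound := fun _ => 1 / (2 * Real.sqrt d)) (s := Iio (1 - d))
    (Iio_mem_nhds (by rw [hd]; linarith))
    (Eventually.of_forall fun x => Continuous.aestronglyMeasurable (by fun_prop))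
    (Continuous.intervalIntegrable (by fun_prop) _ _) ?_ ?_ intervalIntegrable_const ?_
  · refine key.2.congr_deriv ?_
    rw [ellipticKSubE, ← intervalIntegral.integral_div, ← intervalIntegral.integral_neg]
    refine intervalIntegral.integral_congr fun t _ => ?_
    have := (Real.sqrt_pos.2 (one_sub_mul_sin_sq_pos h1 t)).ne'
    field_simp
  · refine Continuous.aestronglyMeasurable (Continuous.div (by fun_prop) (by fun_prop) fun t => ?_)
    exact mul_ne_zero two_ne_zero (Real.sqrt_pos.2 (one_sub_mul_sin_sq_pos h1 t)).ne'
  · refine Eventually.of_forall fun t _ x hx => ?_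
    have h2 := Real.sqrt_le_sqrt (one_sub_mul_sin_sq_ge (by rw [hd]; linarith) (le_of_lt hx) t)
    have h3 := Real.sqrt_pos.2 hd0
    rw [norm_div, norm_neg, Real.norm_of_nonneg (sq_nonneg _), Real.norm_of_nonneg (by positivity)]
    exact div_le_div₀ zero_le_one (Real.sin_sq_le_one t) (by positivity) (by linarith)
  · refine Eventually.of_forall fun t _ x hx => ?_
    have hx1 : x < 1 := lt_of_lt_of_le hx (by linarith)
    have := (((hasDerivAt_id x).mul_const (Real.sin t ^ 2)).const_sub 1).sqrt
      (one_sub_mul_sin_sq_pos hx1 t).ne'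
    simpa using this

theorem hasDerivAt_sin_mul_cos_div_sqrt (h1 : m < 1) (t : ℝ) :
    HasDerivAt (fun t => m * (Real.sin t * Real.cos t) / Real.sqrt (1 - m * Real.sin t ^ 2))
      (Real.sqrt (1 - m * Real.sin t ^ 2)
        - (1 - m) / Real.sqrt (1 - m * Real.sin t ^ 2) ^ 3) t := by
  have hp := one_sub_mul_sin_sq_pos h1 t
  have hq := Real.sqrt_pos.2 hp
  have hsq := Real.sq_sqrt hp.le
  have e1 := (((Real.hasDerivAt_sin t).mul (Real.hasDerivAt_cos t)).const_mul m)
  have e2 := ((((Real.hasDerivAt_sin t).pow 2).const_mul m).const_sub 1).sqrt hp.ne'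
  refine (e1.div e2 hq.ne').congr_deriv ?_
  set q := Real.sqrt (1 - m * Real.sin t ^ 2)
  have hc := Real.cos_sq' t
  simp only [Pi.mul_apply, Pi.pow_apply]
  push_cast
  field_simp
  have h4 : q ^ 4 = (1 - m * Real.sin t ^ 2) ^ 2 := by rw [← hsq]; ring
  ring_nf
  rw [h4, hsq, hc]
  ring

theorem hasDerivAt_ellipticKSubE (h0 : 0 < m) (h1 : m < 1) :
    HasDerivAt ellipticKSubE (ellipticE m / (2 * (1 - m))) m := by
  set d := (1 - m) / 2 with hd
  have hd0 : 0 < d := by rw [hd]; linarith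
  have key := intervalIntegral.hasDerivAt_integral_of_dominated_loc_of_deriv_le
    (μ := MeasureTheory.volume) (a := 0) (b := Real.pi / 2) (x₀ := m)
    (F := fun m t => m * Real.sin t ^ 2 / Real.sqrt (1 - m * Real.sin t ^ 2))
    (F' := fun m t => Real.sin t ^ 2 / Real.sqrt (1 - m * Real.sin t ^ 2)
      + m * Real.sin t ^ 4 / (2 * Real.sqrt (1 - m * Real.sin t ^ 2) ^ 3))
    (bound := fun _ => 1 / Real.sqrt d + 1 / (2 * Real.sqrt d ^ 3)) (s := Ioo 0 (1 - d))
    (Ioo_mem_nhds h0 (by rw [hd]; linarith)) ?_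
    ((continuous_ellipticKSubE_integrand h1).intervalIntegrable _ _) ?_ ?_
    intervalIntegrable_const ?_
  · refine key.2.congr_deriv ?_
    have hg : ∫ t in (0 : ℝ)..(Real.pi / 2), (Real.sqrt (1 - m * Real.sin t ^ 2)
        - (1 - m) / Real.sqrt (1 - m * Real.sin t ^ 2) ^ 3) = 0 := by
      rw [intervalIntegral.integral_eq_sub_of_hasDerivAt
        (fun t _ => hasDerivAt_sin_mul_cos_div_sqrt h1 t)]
      · simp
      · refine Continuous.intervalIntegrable (Continuous.sub (by fun_prop)
          (Continuous.div (by fun_prop) (by fun_prop) fun t => ?_)) _ _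
        exact (pow_pos (Real.sqrt_pos.2 (one_sub_mul_sin_sq_pos h1 t)) 3).ne'
    -- The zero integral is subtracted so that the two integrands agree pointwise.
    have hi : ellipticE m / (2 * (1 - m)) = ellipticE m / (2 * (1 - m))
        - (∫ t in (0 : ℝ)..(Real.pi / 2), (Real.sqrt (1 - m * Real.sin t ^ 2)
        - (1 - m) / Real.sqrt (1 - m * Real.sin t ^ 2) ^ 3)) / (2 * m * (1 - m)) := by
      rw [hg]; simp
    rw [hi, ellipticE, ← intervalIntegral.integral_div, ← intervalIntegral.integral_div,
      ← intervalIntegral.integral_sub]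
    · refine intervalIntegral.integral_congr fun t _ => ?_
      have hp := one_sub_mul_sin_sq_pos h1 t
      have hq := Real.sqrt_pos.2 hp
      have hsq := Real.sq_sqrt hp.le
      set q := Real.sqrt (1 - m * Real.sin t ^ 2)
      have h4 : q ^ 4 = (1 - m * Real.sin t ^ 2) ^ 2 := by rw [← hsq]; ring
      have hm : 1 - m ≠ 0 := by linarith
      field_simp
      ring_nf
      rw [h4, hsq]
      ring
    · exact Continuous.intervalIntegrable (by fun_prop) _ _
    · refine Continuous.intervalIntegrable (Continuous.div_const (Continuous.sub (by fun_prop)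
          (Continuous.div (by fun_prop) (by fun_prop) fun t => ?_)) _) _ _
      exact (pow_pos (Real.sqrt_pos.2 (one_sub_mul_sin_sq_pos h1 t)) 3).ne'
  · filter_upwards [Iio_mem_nhds h1] with x hx
      using (continuous_ellipticKSubE_integrand hx).aestronglyMeasurable
  · have hq := fun t => Real.sqrt_pos.2 (one_sub_mul_sin_sq_pos h1 t)
    refine Continuous.aestronglyMeasurable (Continuous.add
      (Continuous.div (by fun_prop) (by fun_prop) fun t => (hq t).ne')
      (Continuous.div (by fun_prop) (by fun_prop) fun t => ?_))
    exact mul_ne_zero two_ne_zero (pow_pos (hq t) 3).ne'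
  · refine Eventually.of_forall fun t _ x hx => ?_
    have h2 := Real.sqrt_le_sqrt (one_sub_mul_sin_sq_ge (by rw [hd]; linarith) (le_of_lt hx.2) t)
    have h3 := Real.sqrt_pos.2 hd0
    have hs := Real.sin_sq_le_one t
    have hx1 : x ≤ 1 := by linarith [hx.2]
    have hx0 := hx.1
    have h4 : x * Real.sin t ^ 4 ≤ 1 := by
      have : Real.sin t ^ 4 ≤ 1 := by
        rw [show Real.sin t ^ 4 = (Real.sin t ^ 2) ^ 2 by ring]
        exact pow_le_one₀ (sq_nonneg _) hs
      exact mul_le_one₀ hx1 (by positivity) this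
    have h5 : Real.sqrt d ^ 3 ≤ Real.sqrt (1 - x * Real.sin t ^ 2) ^ 3 :=
      pow_le_pow_left₀ h3.le h2 3
    rw [Real.norm_of_nonneg (by positivity)]
    refine add_le_add (div_le_div₀ zero_le_one hs h3 h2) ?_
    exact div_le_div₀ zero_le_one h4 (by positivity) (by linarith)
  · refine Eventually.of_forall fun t _ x hx => ?_
    have hx1 : x < 1 := lt_trans hx.2 (by linarith)
    have hp := one_sub_mul_sin_sq_pos hx1 t
    have hq := Real.sqrt_pos.2 hp
    have hsq := Real.sq_sqrt hp.le
    have e1 := (hasDerivAt_id x).mul_const (Real.sin t ^ 2)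
    have e2 := (e1.const_sub 1).sqrt hp.ne'
    refine (e1.div e2 hq.ne').congr_deriv ?_
    simp only [id]
    set q := Real.sqrt (1 - x * Real.sin t ^ 2)
    field_simp
    ring

/-- Legendre's relation, up to the value of the constant. -/
theorem ellipticE_mul_sub_eq (h0 : 0 < m) (h1 : m < 1) {m' : ℝ} (h0' : 0 < m') (h1' : m' < 1) :
    ellipticE m * ellipticE (1 - m) - ellipticKSubE m * ellipticKSubE (1 - m)
      = ellipticE m' * ellipticE (1 - m') - ellipticKSubE m' * ellipticKSubE (1 - m') := by
  have hd : ∀ x ∈ Ioo (0 : ℝ) 1, HasDerivAt (fun m => ellipticE m * ellipticE (1 - m)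
      - ellipticKSubE m * ellipticKSubE (1 - m)) 0 x := fun x hx => by
    have a1 := hasDerivAt_ellipticE hx.1 hx.2
    have a2 := hasDerivAt_ellipticKSubE hx.1 hx.2
    have hx' : 0 < 1 - x := by linarith [hx.2]
    have hs : HasDerivAt (fun y : ℝ => 1 - y) (-1) x := (hasDerivAt_id x).const_sub 1
    have b1 := (hasDerivAt_ellipticE hx' (by linarith [hx.1])).comp x hs
    have b2 := (hasDerivAt_ellipticKSubE hx' (by linarith [hx.1])).comp x hs
    refine ((a1.mul b1).sub (a2.mul b2)).congr_deriv ?_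
    have := hx.1
    simp only [Function.comp]
    rw [sub_sub_cancel]
    field_simp
    ring
  refine (convex_Ioo (0 : ℝ) 1).is_const_of_fderivWithin_eq_zero (𝕜 := ℝ)
    (f := fun m => ellipticE m * ellipticE (1 - m) - ellipticKSubE m * ellipticKSubE (1 - m))
    (fun x hx => (hd x hx).differentiableAt.differentiableWithinAt) (fun x hx => ?_) ⟨h0, h1⟩
    ⟨h0', h1'⟩
  rw [fderivWithin_of_isOpen isOpen_Ioo hx, (hd x hx).hasFDerivAt.fderiv]
  ext; simp

theorem one_le_ellipticE (h1 : m ≤ 1) : 1 ≤ ellipticE m := by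
  have h : ∫ t in (0 : ℝ)..(Real.pi / 2), Real.cos t = 1 := by simp
  rw [← h]
  refine intervalIntegral.integral_mono_on (by positivity)
    (Continuous.intervalIntegrable (by fun_prop) _ _)
    (Continuous.intervalIntegrable (by fun_prop) _ _) fun t _ => ?_
  refine Real.le_sqrt_of_sq_le ?_
  rw [Real.cos_sq']
  nlinarith [sq_nonneg (Real.sin t)]

theorem ellipticE_le (h0 : 0 ≤ m) : ellipticE m ≤ Real.pi / 2 := by
  have h : ∫ t in (0 : ℝ)..(Real.pi / 2), (1 : ℝ) = Real.pi / 2 := by simp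
  rw [← h]
  refine intervalIntegral.integral_mono_on (by positivity)
    (Continuous.intervalIntegrable (by fun_prop) _ _)
    (Continuous.intervalIntegrable (by fun_prop) _ _) fun t _ => ?_
  refine Real.sqrt_le_one.2 ?_
  nlinarith [sq_nonneg (Real.sin t), mul_nonneg h0 (sq_nonneg (Real.sin t))]

theorem le_ellipticKSubE (h0 : 0 ≤ m) (h1 : m < 1) : m * (Real.pi / 4) ≤ ellipticKSubE m := by
  have h : ∫ t in (0 : ℝ)..(Real.pi / 2), m * Real.sin t ^ 2 = m * (Real.pi / 4) := by
    rw [intervalIntegral.integral_const_mul, integral_sin_sq]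
    simp only [Real.sin_zero, Real.cos_pi_div_two]; ring
  rw [← h]
  refine intervalIntegral.integral_mono_on (by positivity)
    (Continuous.intervalIntegrable (by fun_prop) _ _)
    ((continuous_ellipticKSubE_integrand h1).intervalIntegrable _ _) fun t _ => ?_
  have hp := Real.sqrt_pos.2 (one_sub_mul_sin_sq_pos h1 t)
  refine le_div_self (by positivity) hp (Real.sqrt_le_one.2 ?_)
  nlinarith [sq_nonneg (Real.sin t), mul_nonneg h0 (sq_nonneg (Real.sin t))]

theorem ellipticKSubE_le {d : ℝ} (h0 : 0 ≤ m) (hd : 0 < d) (h1 : m ≤ 1 - d ^ 2) :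
    ellipticKSubE m ≤ m / d * (Real.pi / 2) := by
  have h : ∫ t in (0 : ℝ)..(Real.pi / 2), m / d = m / d * (Real.pi / 2) := by
    simp; ring
  have hm : m < 1 := by nlinarith
  rw [← h]
  refine intervalIntegral.integral_mono_on (by positivity)
    ((continuous_ellipticKSubE_integrand hm).intervalIntegrable _ _)
    (Continuous.intervalIntegrable (by fun_prop) _ _) fun t _ => ?_
  have h2 : d ≤ Real.sqrt (1 - m * Real.sin t ^ 2) :=
    Real.le_sqrt_of_sq_le (one_sub_mul_sin_sq_ge (by linarith) h1 t)
  exact div_le_div₀ h0 (mul_le_of_le_one_right h0 (Real.sin_sq_le_one t)) hd h2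

/-- The expression is constant in `m`, so crude bounds at one small parameter suffice: at `m =
1/100` the first product is at least `1` and the second at most `0.02 · 16`. -/
theorem ellipticE_mul_sub_pos (h0 : 0 < m) (h1 : m < 1) :
    0 < ellipticE m * ellipticE (1 - m) - ellipticKSubE m * ellipticKSubE (1 - m) := by
  rw [ellipticE_mul_sub_eq h0 h1 (m' := 1 / 100) (by norm_num) (by norm_num)]
  have a1 := one_le_ellipticE (m := 1 / 100) (by norm_num)
  have a2 := one_le_ellipticE (m := 1 - 1 / 100) (by norm_num)
  have b1 := ellipticKSubE_le (m := 1 / 100) (d := 9 / 10) (by norm_num) (by norm_num) (by norm_num)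
  have b2 := ellipticKSubE_le (m := 1 - 1 / 100) (d := 1 / 10) (by norm_num) (by norm_num)
    (by norm_num)
  have c2 := le_ellipticKSubE (m := 1 - 1 / 100) (by norm_num) (by norm_num)
  have hpi := Real.pi_lt_d2
  have hpi' := Real.pi_pos
  have b1' : ellipticKSubE (1 / 100) ≤ 2 / 100 := b1.trans (by linarith)
  have b2' : ellipticKSubE (1 - 1 / 100) ≤ 16 := b2.trans (by linarith)
  have c2' : 0 ≤ ellipticKSubE (1 - 1 / 100) := le_trans (by positivity) c2
  have := mul_le_mul b1' b2' c2' (by norm_num)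
  nlinarith

end elliptic

/-! ### The edge curve in terms of elliptic integrals, and its velocity. -/

section edge
variable {y : ℝ}

theorem one_div_sq_cosh_mem (hy : 0 < y) : 1 / Real.cosh y ^ 2 ∈ Ioo (0 : ℝ) 1 := by
  have h1 : 1 < Real.cosh y := Real.one_lt_cosh.2 hy.ne'
  refine ⟨by positivity, ?_⟩
  rw [div_lt_one (by positivity)]
  exact one_lt_pow₀ h1 two_ne_zero

/-- Substitute `sinh s = sinh y sin t`, then reflect `t ↦ π/2 - t`. -/
theorem integral_sqrt_one_sub_cosh_sq (hy : 0 < y) :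
    ∫ s in (0 : ℝ)..y, Real.sqrt (1 - (Real.cosh s / Real.cosh y) ^ 2)
      = ellipticKSubE (1 - 1 / Real.cosh y ^ 2) := by
  have hc := Real.cosh_pos y
  have hs : 0 < Real.sinh y := Real.sinh_pos_iff.2 hy
  have hcs := Real.cosh_sq y
  have hsub := intervalIntegral.integral_comp_mul_deriv (a := 0) (b := Real.pi / 2)
    (f := fun t => Real.arsinh (Real.sinh y * Real.sin t))
    (f' := fun t => (Real.sqrt (1 + (Real.sinh y * Real.sin t) ^ 2))⁻¹
      * (Real.sinh y * Real.cos t))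
    (g := fun s => Real.sqrt (1 - (Real.cosh s / Real.cosh y) ^ 2)) ?_ ?_ (by fun_prop)
  · simp only [Real.sin_zero, mul_zero, Real.arsinh_zero, Real.sin_pi_div_two, mul_one,
      Real.arsinh_sinh] at hsub
    rw [← hsub, ellipticKSubE]
    have hflip := intervalIntegral.integral_comp_sub_left (a := 0) (b := Real.pi / 2)
      (fun t => (1 - 1 / Real.cosh y ^ 2) * Real.sin t ^ 2 /
        Real.sqrt (1 - (1 - 1 / Real.cosh y ^ 2) * Real.sin t ^ 2)) (Real.pi / 2)
    rw [sub_self, sub_zero] at hflip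
    rw [← hflip]
    refine intervalIntegral.integral_congr fun t ht => ?_
    rw [uIcc_of_le (by positivity)] at ht
    have hct : 0 ≤ Real.cos t := Real.cos_nonneg_of_mem_Icc ⟨by linarith [ht.1, Real.pi_pos], ht.2⟩
    simp only [Function.comp, Real.sin_pi_div_two_sub]
    have hp : 0 < 1 + (Real.sinh y * Real.sin t) ^ 2 := by positivity
    have hsq := Real.sin_sq t
    have e1 : 1 - (Real.cosh (Real.arsinh (Real.sinh y * Real.sin t)) / Real.cosh y) ^ 2
        = (Real.sinh y * Real.cos t / Real.cosh y) ^ 2 := by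
      rw [div_pow, Real.cosh_sq (Real.arsinh _), Real.sinh_arsinh]
      field_simp
      rw [hcs, hsq]; ring
    have e2 : 1 - (1 - 1 / Real.cosh y ^ 2) * Real.cos t ^ 2
        = (1 + (Real.sinh y * Real.sin t) ^ 2) / Real.cosh y ^ 2 := by
      field_simp
      rw [hcs, hsq]; ring
    rw [e1, e2, Real.sqrt_sq (by positivity), Real.sqrt_div' _ (by positivity),
      Real.sqrt_sq hc.le]
    have hq := Real.sqrt_pos.2 hp
    field_simp
    rw [hcs]; ring
  · intro t _
    exact (Real.hasDerivAt_arsinh _).comp t ((Real.hasDerivAt_sin t).const_mul (Real.sinh y))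
  · refine ContinuousOn.mul (ContinuousOn.inv₀ (by fun_prop) fun t _ => ?_) (by fun_prop)
    exact (Real.sqrt_pos.2 (by positivity)).ne'

theorem ellipticKSubE_le_self (hy : 0 < y) : ellipticKSubE (1 - 1 / Real.cosh y ^ 2) ≤ y := by
  rw [← integral_sqrt_one_sub_cosh_sq hy]
  have h : ∫ s in (0 : ℝ)..y, (1 : ℝ) = y := by simp
  conv_rhs => rw [← h]
  refine intervalIntegral.integral_mono_on hy.le
    (Continuous.intervalIntegrable (by fun_prop) _ _)
    (Continuous.intervalIntegrable (by fun_prop) _ _) fun t _ => Real.sqrt_le_one.2 ?_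
  have := sq_nonneg (Real.cosh t / Real.cosh y)
  linarith

theorem haagerupLift_edge (hy : 0 < y) :
    haagerupLift ((Real.pi / 2 : ℝ) + y * Complex.I)
      = (ellipticE (1 / Real.cosh y ^ 2) : ℂ)
        + (ellipticKSubE (1 - 1 / Real.cosh y ^ 2) : ℂ) * Complex.I := by
  rw [haagerupLift_pi_div_two_add_mul_I hy, integral_sqrt_one_sub_cosh_sq hy, ellipticE]
  have h : ∀ t, (Real.sin t / Real.cosh y) ^ 2 = 1 / Real.cosh y ^ 2 * Real.sin t ^ 2 := fun t => by
    rw [div_pow]; ring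
  simp only [h]

theorem hasDerivAt_one_div_sq_cosh (y : ℝ) :
    HasDerivAt (fun y => 1 / Real.cosh y ^ 2) (-(2 * Real.sinh y / Real.cosh y ^ 3)) y := by
  have hc := Real.cosh_pos y
  have h := ((Real.hasDerivAt_cosh y).pow 2).inv (pow_pos hc 2).ne'
  simp only [one_div]
  refine h.congr_deriv ?_
  simp only [Pi.pow_apply]
  push_cast
  field_simp

theorem hasDerivAt_haagerupLift_edge (hy : 0 < y) :
    HasDerivAt (fun y : ℝ => haagerupLift ((Real.pi / 2 : ℝ) + y * Complex.I))
      (((Real.sinh y / Real.cosh y * ellipticKSubE (1 / Real.cosh y ^ 2) : ℝ) : ℂ)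
        + ((Real.sinh y / Real.cosh y * ellipticE (1 - 1 / Real.cosh y ^ 2) : ℝ) : ℂ)
          * Complex.I) y := by
  have hc := Real.cosh_pos y
  have hm := one_div_sq_cosh_mem hy
  have d0 := hasDerivAt_one_div_sq_cosh y
  have d1 := (hasDerivAt_ellipticE hm.1 hm.2).comp y d0
  have d2 := (hasDerivAt_ellipticKSubE (m := 1 - 1 / Real.cosh y ^ 2) (by linarith [hm.2])
    (by linarith [hm.1])).comp y (d0.const_sub 1)
  have e1 : -(ellipticKSubE (1 / Real.cosh y ^ 2) / (2 * (1 / Real.cosh y ^ 2)))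
      * -(2 * Real.sinh y / Real.cosh y ^ 3)
      = Real.sinh y / Real.cosh y * ellipticKSubE (1 / Real.cosh y ^ 2) := by
    field_simp
  have e2 : ellipticE (1 - 1 / Real.cosh y ^ 2) / (2 * (1 - (1 - 1 / Real.cosh y ^ 2)))
      * -(-(2 * Real.sinh y / Real.cosh y ^ 3))
      = Real.sinh y / Real.cosh y * ellipticE (1 - 1 / Real.cosh y ^ 2) := by
    rw [sub_sub_cancel]; field_simp
  rw [e1] at d1; rw [e2] at d2
  refine (d1.ofReal_comp.add (d2.ofReal_comp.mul_const Complex.I)).congr_of_eventuallyEq ?_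
  filter_upwards [Ioi_mem_nhds hy] with x hx
  exact haagerupLift_edge hx

theorem continuousOn_haagerupLift_edge :
    Continuous (fun y : ℝ => haagerupLift ((Real.pi / 2 : ℝ) + y * Complex.I)) := by
  refine continuousOn_haagerupLift.comp_continuous (by fun_prop) fun y => ?_
  simp [abs_of_pos Real.pi_div_two_pos]

end edge

/-! ### The sign of the right-edge integral. -/

/-- A lower bound for an oscillatory integral along a curve in polar coordinates `exp u`, `φ`. -/
theorem le_integral_sinh_mul_exp_mul_sin {n : ℕ} (hn : 2 ≤ n) {u φ S : ℝ → ℝ} {C a b U δ : ℝ}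
    (ha : 0 ≤ a) (hab : a ≤ b) (hC : 0 < C) (hδ : 0 ≤ δ)
    (hu : ContinuousOn u (Icc 0 b)) (hφ : ContinuousOn φ (Icc 0 b)) (hφ0 : φ 0 = 0)
    (hu' : ∀ y ∈ Ioo 0 b, HasDerivAt u (Real.sinh y / Real.cosh y * (S y / Real.exp (u y) ^ 2)) y)
    (hφ' : ∀ y ∈ Ioo 0 b, HasDerivAt φ (Real.sinh y / Real.cosh y * (C / Real.exp (u y) ^ 2)) y)
    (hS : ∀ y ∈ Ioo 0 b, Real.exp (u y) ^ 2 ≤ (n - 2) * S y)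
    (hSa : ∀ y ∈ Ioo 0 a, Real.exp (u y) ^ 2 + δ ≤ (n - 2) * S y)
    (hU : ∀ y ∈ Ioo 0 a, u y ≤ U) :
    Real.exp (-((n - 2) * U)) * δ / (n * C ^ 2) * (φ a - 1 / n)
      ≤ ∫ y in (0 : ℝ)..b, Real.sinh y * (Real.exp (-(n * u y)) * Real.sin (n * φ y)) := by
  have hn0 : (0 : ℝ) < n := by exact_mod_cast (by omega : 0 < n)
  have hn2 : (0 : ℝ) ≤ n - 2 := by
    have : (2 : ℝ) ≤ n := by exact_mod_cast hn
    linarith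
  set F : ℝ → ℝ := fun y => Real.sinh y * (Real.exp (-(n * u y)) * Real.sin (n * φ y)) with hF
  -- Integration by parts: `n φ' sin (nφ)` is the derivative of `1 - cos (nφ)`, and `sinh y e^(-nu)
  -- / (n φ') = cosh y e^(-(n-2)u) / (nC)`. By `hS` this weight is nonincreasing, so `Θ' ≤ F` and `∫
  -- F ≥ Θ b - Θ 0 ≥ 0`.
  set Θ : ℝ → ℝ := fun y =>
    Real.cosh y * (Real.exp (-((n - 2) * u y)) * (1 - Real.cos (n * φ y))) / (n * C) with hΘ
  have hFc : ContinuousOn F (Icc 0 b) := by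
    refine Real.continuous_sinh.continuousOn.mul (ContinuousOn.mul ?_ ?_)
    · exact Real.continuous_exp.comp_continuousOn (hu.const_smul (n : ℝ)).neg
    · exact Real.continuous_sin.comp_continuousOn (hφ.const_smul (n : ℝ))
  have hΘc : ContinuousOn Θ (Icc 0 b) := by
    refine ContinuousOn.div_const (Real.continuous_cosh.continuousOn.mul (ContinuousOn.mul ?_ ?_)) _
    · exact Real.continuous_exp.comp_continuousOn (hu.const_smul (n - 2 : ℝ)).neg
    · exact continuousOn_const.sub
        (Real.continuous_cos.comp_continuousOn (hφ.const_smul (n : ℝ)))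
  have hexp : ∀ y, Real.exp (-((n - 2) * u y)) = Real.exp (-(n * u y)) * Real.exp (u y) ^ 2 := by
    intro y
    rw [← Real.exp_nat_mul, ← Real.exp_add]; congr 1; push_cast; ring
  have hΘd : ∀ y ∈ Ioo 0 b, HasDerivAt Θ (F y - Real.sinh y * Real.exp (-(n * u y))
      * (1 - Real.cos (n * φ y)) * ((n - 2) * S y - Real.exp (u y) ^ 2) / (n * C)) y := by
    intro y hy
    have d1 := (((hu' y hy).const_mul ((n : ℝ) - 2)).neg).exp
    have d2 := (((hφ' y hy).const_mul (n : ℝ)).cos).const_sub 1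
    refine (((Real.hasDerivAt_cosh y).mul (d1.mul d2)).div_const (n * C)).congr_deriv ?_
    have hc := Real.cosh_pos y
    have he := Real.exp_pos (u y)
    simp only [Pi.mul_apply, Pi.neg_apply, hF]
    rw [hexp]
    field_simp
    ring
  have hFi : ∀ p q : ℝ, 0 ≤ p → q ≤ b → MeasureTheory.IntegrableOn F (Icc p q) := fun p q hp hq =>
    (hFc.mono (Icc_subset_Icc hp hq)).integrableOn_Icc
  -- On `(0, a)` the slack `δ` improves this to `F ≥ Θ' + k (1 - cos (nφ)) φ'`; the extra term
  -- integrates to `k (φ a - sin (nφ a) / n)`.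
  set k := Real.exp (-((n - 2) * U)) * δ / (n * C ^ 2) with hk
  have hk0 : 0 ≤ k := by positivity
  have i1 := intervalIntegral.sub_le_integral_of_hasDeriv_right_of_le (a := 0) (b := a)
    (g := fun y => Θ y + k * (φ y - Real.sin (n * φ y) / n))
    (g' := fun y => F y - Real.sinh y * Real.exp (-(n * u y))
      * (1 - Real.cos (n * φ y)) * ((n - 2) * S y - Real.exp (u y) ^ 2) / (n * C)
      + k * ((1 - Real.cos (n * φ y)) * (Real.sinh y / Real.cosh y * (C / Real.exp (u y) ^ 2))))
    (φ := F) ha ?_ ?_ (hFi _ _ le_rfl hab) ?_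
  · have i2 := intervalIntegral.sub_le_integral_of_hasDeriv_right_of_le (a := a) (b := b)
      (g := Θ) (g' := fun y => F y - Real.sinh y * Real.exp (-(n * u y))
      * (1 - Real.cos (n * φ y)) * ((n - 2) * S y - Real.exp (u y) ^ 2) / (n * C))
      (φ := F) hab (hΘc.mono (Icc_subset_Icc ha le_rfl)) ?_ (hFi _ _ ha le_rfl) ?_
    · have hadd := intervalIntegral.integral_add_adjacent_intervals (a := 0) (b := a) (c := b)
        (f := F) (μ := MeasureTheory.volume)
        ((hFc.mono (by rw [uIcc_of_le ha]; exact Icc_subset_Icc le_rfl hab)).intervalIntegrable)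
        ((hFc.mono (by rw [uIcc_of_le hab]; exact Icc_subset_Icc ha le_rfl)).intervalIntegrable)
      have hΘ0 : Θ 0 = 0 := by simp [hΘ, hφ0]
      have hΘb : 0 ≤ Θ b := by
        have := Real.cosh_pos b
        have := Real.cos_le_one (n * φ b)
        have h1 : 0 ≤ 1 - Real.cos (n * φ b) := by linarith
        simp only [hΘ]; positivity
      simp only [hφ0, mul_zero, Real.sin_zero, zero_div, sub_zero, hΘ0, add_zero] at i1
      have hs : Real.sin (n * φ a) / n ≤ 1 / n :=
        div_le_div_of_nonneg_right (Real.sin_le_one _) hn0.le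
      have := mul_le_mul_of_nonneg_left (sub_le_sub_left hs (φ a)) hk0
      linarith
    · intro y hy
      exact (hΘd y ⟨ha.trans_lt hy.1, hy.2⟩).hasDerivWithinAt
    · intro y hy
      have hy0 : 0 < y := ha.trans_lt hy.1
      have h1 : 0 ≤ 1 - Real.cos (n * φ y) := by linarith [Real.cos_le_one (n * φ y)]
      have h2 : 0 ≤ (n - 2) * S y - Real.exp (u y) ^ 2 := by linarith [hS y ⟨hy0, hy.2⟩]
      have h3 := Real.sinh_pos_iff.2 hy0
      rw [sub_le_self_iff]
      positivity
  · have hφa := hφ.mono (Icc_subset_Icc le_rfl hab)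
    refine (hΘc.mono (Icc_subset_Icc le_rfl hab)).add (continuousOn_const.mul (hφa.sub ?_))
    exact (Real.continuous_sin.comp_continuousOn (hφa.const_smul (n : ℝ))).div_const _
  · intro y hy
    have hy' : y ∈ Ioo 0 b := ⟨hy.1, hy.2.trans_le hab⟩
    have d2 := (((hφ' y hy').const_mul (n : ℝ)).sin).div_const (n : ℝ)
    refine HasDerivAt.hasDerivWithinAt ?_
    refine ((hΘd y hy').add (((hφ' y hy').sub d2).const_mul k)).congr_deriv ?_
    field_simp
  · intro y hy
    have h1 : 0 ≤ 1 - Real.cos (n * φ y) := by linarith [Real.cos_le_one (n * φ y)]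
    have h3 := Real.sinh_pos_iff.2 hy.1
    have hc := Real.one_le_cosh y
    have he := Real.exp_pos (u y)
    have h4 : δ ≤ (n - 2) * S y - Real.exp (u y) ^ 2 := by linarith [hSa y hy]
    have h5 : Real.exp (-((n - 2) * U)) ≤ Real.exp (-((n - 2) * u y)) :=
      Real.exp_le_exp.2 (neg_le_neg (mul_le_mul_of_nonneg_left (hU y hy) hn2))
    have h6 : Real.sinh y / Real.cosh y ≤ Real.sinh y := div_le_self h3.le hc
    have key : k * ((1 - Real.cos (n * φ y)) * (Real.sinh y / Real.cosh y
          * (C / Real.exp (u y) ^ 2)))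
        ≤ Real.sinh y * Real.exp (-(n * u y)) * (1 - Real.cos (n * φ y))
          * ((n - 2) * S y - Real.exp (u y) ^ 2) / (n * C) := by
      calc k * ((1 - Real.cos (n * φ y)) * (Real.sinh y / Real.cosh y
            * (C / Real.exp (u y) ^ 2)))
          = Real.exp (-((n - 2) * U)) * δ * ((1 - Real.cos (n * φ y)) / (n * C)
              / Real.exp (u y) ^ 2) * (Real.sinh y / Real.cosh y) := by
            rw [hk]; field_simp
        _ ≤ Real.exp (-((n - 2) * u y)) * ((n - 2) * S y - Real.exp (u y) ^ 2)
              * ((1 - Real.cos (n * φ y)) / (n * C) / Real.exp (u y) ^ 2) * Real.sinh y := by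
            have h7 := hδ.trans h4
            gcongr
        _ = _ := by rw [hexp]; field_simp
    linarith

theorem im_integral_edge_le {n : ℕ} (hn : 21 ≤ n) :
    (∫ y in (0 : ℝ)..4, (Real.sinh y : ℂ)
      * (haagerupLift ((Real.pi / 2 : ℝ) + y * Complex.I) ^ n)⁻¹).im ≤ -(45 * (3 ^ n)⁻¹) := by
  set g : ℝ → ℂ := fun y => haagerupLift ((Real.pi / 2 : ℝ) + y * Complex.I) with hg
  have hgc : Continuous g := continuousOn_haagerupLift_edge
  have hre : ∀ y : ℝ, |((Real.pi / 2 : ℝ) + y * Complex.I : ℂ).re| ≤ Real.pi / 2 := fun y => by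
    simp [abs_of_pos Real.pi_div_two_pos]
  have hne : ∀ y : ℝ, ((Real.pi / 2 : ℝ) + y * Complex.I : ℂ) ≠ 0 := fun y h => by
    have := congrArg Complex.re h
    simp at this
  have hsl : ∀ y, g y ∈ Complex.slitPlane := fun y =>
    haagerupLift_mem_slitPlane (hre y) (hne y) (by simp [Real.pi_div_two_pos.le])
  have hg0 : ∀ y, g y ≠ 0 := fun y => Complex.slitPlane_ne_zero (hsl y)
  set u : ℝ → ℝ := fun y => (Complex.log (g y)).re with hu
  set φ : ℝ → ℝ := fun y => (Complex.log (g y)).im with hφ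
  have hlc : Continuous fun y => Complex.log (g y) := hgc.clog hsl
  have huc : Continuous u := Complex.continuous_re.comp hlc
  have hφc : Continuous φ := Complex.continuous_im.comp hlc
  have hexp : ∀ y, Real.exp (u y) = ‖g y‖ := fun y => by
    simp only [hu]; rw [← Complex.norm_exp, Complex.exp_log (hg0 y)]
  set m : ℝ → ℝ := fun y => 1 / Real.cosh y ^ 2 with hm
  set A : ℝ → ℝ := fun y => ellipticE (m y) with hA
  set J : ℝ → ℝ := fun y => ellipticKSubE (1 - m y) with hJ
  set S : ℝ → ℝ := fun y => A y * ellipticKSubE (m y) + J y * ellipticE (1 - m y) with hS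
  have hgA : ∀ y, 0 < y → g y = (A y : ℂ) + (J y : ℂ) * Complex.I := fun y hy =>
    haagerupLift_edge hy
  have hnorm : ∀ y, 0 < y → Real.exp (u y) ^ 2 = A y ^ 2 + J y ^ 2 := fun y hy => by
    rw [hexp, hgA y hy, ← Complex.normSq_eq_norm_sq, Complex.normSq_add_mul_I]
  have hmem : ∀ y, 0 < y → m y ∈ Ioo (0 : ℝ) 1 := fun y hy => one_div_sq_cosh_mem hy
  -- Legendre's relation. Only `0 < C ≤ (π/2)²` is used, not the value of `C`.
  obtain ⟨C, hC⟩ : ∃ C, ∀ y, 0 < y →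
      A y * ellipticE (1 - m y) - ellipticKSubE (m y) * J y = C :=
    ⟨_, fun y hy => ellipticE_mul_sub_eq (hmem y hy).1 (hmem y hy).2 (m' := 1 / 2) (by norm_num)
      (by norm_num)⟩
  have hpi := Real.pi_pos
  have hpi1 := Real.pi_gt_d2
  have hpi2 := Real.pi_lt_d4
  have bA : ∀ y, 0 < y → 1 ≤ A y ∧ A y ≤ Real.pi / 2 := fun y hy =>
    ⟨one_le_ellipticE (hmem y hy).2.le, ellipticE_le (hmem y hy).1.le⟩
  have bE : ∀ y, 0 < y → 1 ≤ ellipticE (1 - m y) ∧ ellipticE (1 - m y) ≤ Real.pi / 2 :=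
    fun y hy => ⟨one_le_ellipticE (by linarith [(hmem y hy).1]),
      ellipticE_le (by linarith [(hmem y hy).2])⟩
  have bK : ∀ y, 0 < y → m y * (Real.pi / 4) ≤ ellipticKSubE (m y) := fun y hy =>
    le_ellipticKSubE (hmem y hy).1.le (hmem y hy).2
  have bJ : ∀ y, 0 < y → (1 - m y) * (Real.pi / 4) ≤ J y ∧ J y ≤ y := fun y hy =>
    ⟨le_ellipticKSubE (by linarith [(hmem y hy).2]) (by linarith [(hmem y hy).1]),
      ellipticKSubE_le_self hy⟩
  have bJ0 : ∀ y, 0 < y → 0 ≤ J y := fun y hy =>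
    le_trans (mul_nonneg (by linarith [(hmem y hy).2]) (by positivity)) (bJ y hy).1
  have bK0 : ∀ y, 0 < y → 0 ≤ ellipticKSubE (m y) := fun y hy =>
    le_trans (mul_nonneg (hmem y hy).1.le (by positivity)) (bK y hy)
  have hCpos : 0 < C := by
    rw [← hC 1 one_pos]
    exact ellipticE_mul_sub_pos (hmem 1 one_pos).1 (hmem 1 one_pos).2
  have hCle : C ≤ 2.468 := by
    rw [← hC 1 one_pos]
    have h1 := mul_nonneg (bK0 1 one_pos) (bJ0 1 one_pos)
    have h2 := mul_le_mul (bA 1 one_pos).2 (bE 1 one_pos).2 (by linarith [(bE 1 one_pos).1])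
      (by positivity)
    nlinarith
  have hAsq : ∀ y, 0 < y → A y ^ 2 ≤ 2.4675 := fun y hy => by
    have h1 := pow_le_pow_left₀ (by linarith [(bA y hy).1]) (bA y hy).2 2
    nlinarith
  have hSJ : ∀ y, 0 < y → J y ≤ S y := fun y hy => by
    have h1 := mul_nonneg (le_trans zero_le_one (bA y hy).1) (bK0 y hy)
    have h2 := mul_le_mul_of_nonneg_left (bE y hy).1 (bJ0 y hy)
    simp only [hS]; linarith
  have hSpi : ∀ y, 0 < y → 0.785 ≤ S y := fun y hy => by
    have h1 := mul_le_mul_of_nonneg_right (bA y hy).1 (bK0 y hy)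
    have h2 := mul_le_mul_of_nonneg_left (bE y hy).1 (bJ0 y hy)
    simp only [hS]
    nlinarith [bK y hy, (bJ y hy).1]
  have hn' : (21 : ℝ) ≤ n := by exact_mod_cast hn
  have hρ1 : ∀ y ∈ Ioc (0 : ℝ) 1, Real.exp (u y) ^ 2 ≤ 3.4675 := fun y hy => by
    rw [hnorm y hy.1]
    have h1 := (bJ y hy.1).2.trans hy.2
    have h2 := pow_le_one₀ (n := 2) (bJ0 y hy.1) h1
    linarith [hAsq y hy.1]
  have hgd : ∀ y, 0 < y → HasDerivAt (fun y => Complex.log (g y))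
      ((((Real.sinh y / Real.cosh y * ellipticKSubE (m y) : ℝ) : ℂ)
        + ((Real.sinh y / Real.cosh y * ellipticE (1 - m y) : ℝ) : ℂ) * Complex.I) / g y) y :=
    fun y hy => (hasDerivAt_haagerupLift_edge hy).clog_real (hsl y)
  -- Multiplying numerator and denominator by the conjugate of `g y` puts `S` in the real part and
  -- Legendre's constant in the imaginary part.
  have hquot : ∀ y, 0 < y → (((Real.sinh y / Real.cosh y * ellipticKSubE (m y) : ℝ) : ℂ)
        + ((Real.sinh y / Real.cosh y * ellipticE (1 - m y) : ℝ) : ℂ) * Complex.I) / g y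
      = ((Real.sinh y / Real.cosh y * (S y / Real.exp (u y) ^ 2) : ℝ) : ℂ)
        + ((Real.sinh y / Real.cosh y * (C / Real.exp (u y) ^ 2) : ℝ) : ℂ) * Complex.I := by
    intro y hy
    rw [div_eq_iff (hg0 y), hgA y hy]
    have hr : A y ^ 2 + J y ^ 2 ≠ 0 := by rw [← hnorm y hy]; positivity
    rw [hnorm y hy, ← hC y hy]
    have hc := (Real.cosh_pos y).ne'
    apply Complex.ext
    · simp [-Complex.ofReal_mul, -Complex.ofReal_div, -Complex.ofReal_cosh, -Complex.ofReal_sinh]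
      simp only [hS]
      field_simp
      ring
    · simp [-Complex.ofReal_mul, -Complex.ofReal_div, -Complex.ofReal_cosh, -Complex.ofReal_sinh]
      simp only [hS]
      field_simp
      ring
  have hφ0 : φ 0 = 0 := by
    have h1 := haagerupLift_ofReal (s := Real.pi / 2) (by rw [abs_of_pos (by positivity)])
    have h2 := re_integral_haagerupLiftIntegrand_pos (hre 0) (hne 0)
    simp only [hφ, hg, Complex.log_im]
    rw [Complex.arg_eq_zero_iff]
    simp only [Complex.ofReal_zero, zero_mul, add_zero] at h2 ⊢
    refine ⟨?_, by rw [h1, Complex.ofReal_im]⟩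
    rw [haagerupLift, Complex.re_ofReal_mul]
    exact mul_nonneg (by positivity) h2.le
  have hφ1 : 0.2 ≤ φ 1 := by
    have hsin : Real.sin (φ 1) = J 1 / ‖g 1‖ := by
      simp only [hφ, Complex.log_im]
      rw [Complex.sin_arg, hgA 1 one_pos]; simp
    have h0 : 0 ≤ φ 1 := by
      simp only [hφ, Complex.log_im]
      rw [Complex.arg_nonneg_iff, hgA 1 one_pos]
      simpa using bJ0 1 one_pos
    have h1 : ‖g 1‖ ≤ 1.87 := by
      have := hρ1 1 ⟨one_pos, le_rfl⟩
      rw [hexp] at this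
      exact abs_le_of_sq_le_sq' (by linarith) (by norm_num) |>.2
    have h2 : (1 : ℝ) ≤ Real.sinh 1 := Real.self_le_sinh_iff.2 zero_le_one
    have h3 : m 1 ≤ 1 / 2 := by
      simp only [hm]
      rw [Real.cosh_sq]
      exact one_div_le_one_div_of_le (by norm_num) (by nlinarith)
    have h4 : 0.3925 ≤ J 1 := by nlinarith [(bJ 1 one_pos).1]
    have h5 : 0.2 ≤ J 1 / ‖g 1‖ := by
      rw [le_div_iff₀ (norm_pos_iff.2 (hg0 1))]
      linarith
    rw [← hsin] at h5
    exact h5.trans (Real.sin_le h0)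
  -- The gain is collected on `(0, 1)`, where `J ≤ 1` gives `|g|² ≤ (π/2)² + 1 < 1.87² < 3.5`;
  -- together with `S ≥ 0.785` this yields `U` and `δ`.
  have key := le_integral_sinh_mul_exp_mul_sin (n := n) (by omega) (u := u) (φ := φ) (S := S)
    (C := C) (a := 1) (b := 4) (U := Real.log 1.87) (δ := (n - 2) * 0.785 - 3.5)
    zero_le_one (by norm_num) hCpos (by linarith) huc.continuousOn hφc.continuousOn hφ0
    (fun y hy => ?_) (fun y hy => ?_) (fun y hy => ?_) (fun y hy => ?_) (fun y hy => ?_)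
  · have hint : (∫ y in (0 : ℝ)..4, (Real.sinh y : ℂ) * (g y ^ n)⁻¹).im
        = -∫ y in (0 : ℝ)..4, Real.sinh y * (Real.exp (-(n * u y)) * Real.sin (n * φ y)) := by
      have hc : Continuous fun y => (Real.sinh y : ℂ) * (g y ^ n)⁻¹ :=
        (Complex.continuous_ofReal.comp Real.continuous_sinh).mul
          ((hgc.pow n).inv₀ fun y => pow_ne_zero n (hg0 y))
      rw [← intervalIntegral.integral_neg]
      refine ((Complex.imCLM.intervalIntegral_comp_comm (hc.intervalIntegrable 0 4)).symm).trans ?_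
      refine intervalIntegral.integral_congr fun y _ => ?_
      have h1 : (g y ^ n)⁻¹ = Complex.exp (-(n * Complex.log (g y))) := by
        rw [Complex.exp_neg, Complex.exp_nat_mul, Complex.exp_log (hg0 y)]
      simp only [Complex.imCLM_apply]
      rw [h1, Complex.im_ofReal_mul, Complex.exp_im]
      simp [hu, hφ]
    rw [hint, neg_le_neg_iff]
    refine le_trans ?_ key
    have hE : Real.exp (-((n - 2) * Real.log 1.87)) = 1.87 ^ 2 * (1.87 ^ n)⁻¹ := by
      rw [← Real.exp_log (show (0 : ℝ) < 1.87 by norm_num), ← Real.exp_nat_mul, ← Real.exp_nat_mul,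
        ← Real.exp_neg, ← Real.exp_add, Real.exp_log (by norm_num)]
      congr 1; push_cast; ring
    have hδ : 1 / 2 ≤ ((n - 2) * 0.785 - 3.5) / (n : ℝ) := by
      rw [le_div_iff₀ (by linarith)]; linarith
    have hinv : 1 / (n : ℝ) ≤ 0.05 := by
      rw [div_le_iff₀ (by linarith)]; linarith
    have hC2 : 1 / 6.1 ≤ 1 / C ^ 2 := by
      refine one_div_le_one_div_of_le (by positivity) ?_
      nlinarith
    -- The margin decays like `1.87⁻ⁿ`, the top edge only contributes `45 · 3⁻ⁿ`; from `n = 21` on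
    -- the ratio absorbs all remaining constants.
    have hpow : (2000 : ℝ) ≤ (3 / 1.87) ^ n := by
      refine le_trans ?_ (pow_le_pow_right₀ (by norm_num) hn)
      norm_num
    have h3 : 2000 * (3 ^ n)⁻¹ ≤ ((1.87 : ℝ) ^ n)⁻¹ := by
      rw [div_pow] at hpow
      rw [← div_eq_mul_inv, div_le_iff₀ (by positivity)]
      calc (2000 : ℝ) ≤ 3 ^ n / 1.87 ^ n := hpow
        _ = _ := by rw [div_eq_mul_inv, mul_comm]
    rw [hE]
    calc 45 * (3 ^ n : ℝ)⁻¹ ≤ 1.87 ^ 2 * (2000 * (3 ^ n)⁻¹) * (1 / 2) * (1 / 6.1) * 0.15 := by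
          have : (0 : ℝ) ≤ (3 ^ n)⁻¹ := by positivity
          nlinarith
      _ ≤ 1.87 ^ 2 * (1.87 ^ n)⁻¹ * (((n - 2) * 0.785 - 3.5) / (n : ℝ)) * (1 / C ^ 2)
            * (φ 1 - 1 / n) := by
          gcongr
          linarith
      _ = _ := by
          have : (n : ℝ) ≠ 0 := by linarith
          field_simp
  · have h := hgd y hy.1
    rw [hquot y hy.1] at h
    refine (Complex.reCLM.hasFDerivAt.comp_hasDerivAt y h).congr_deriv ?_
    simp only [Complex.reCLM_apply, Complex.add_re, Complex.ofReal_re, Complex.re_ofReal_mul,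
      Complex.I_re, mul_zero, add_zero]
  · have h := hgd y hy.1
    rw [hquot y hy.1] at h
    refine (Complex.imCLM.hasFDerivAt.comp_hasDerivAt y h).congr_deriv ?_
    simp only [Complex.imCLM_apply, Complex.add_im, Complex.ofReal_im, Complex.im_ofReal_mul,
      Complex.I_im, mul_one, zero_add]
  -- On `(0, 4)`, `J ≤ 4` gives `|g|² ≤ A² + 4 J ≤ 2.4675 + 4 S`, which is below `19 S ≤ (n - 2) S`.
  · rw [hnorm y hy.1]
    have h1 := (bJ y hy.1).2.trans hy.2.le
    have h2 := bJ0 y hy.1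
    nlinarith [hAsq y hy.1, hSJ y hy.1, hSpi y hy.1]
  · have := hρ1 y ⟨hy.1, hy.2.le⟩
    nlinarith [hSpi y hy.1]
  · have := hρ1 y ⟨hy.1, hy.2.le⟩
    rw [Real.le_log_iff_exp_le (by norm_num)]
    exact abs_le_of_sq_le_sq' (by linarith) (by norm_num) |>.2

/-! ### The top edge at height `4`. -/

section top

/-- The integrand differs from `1` by at most `cosh² (4r) / sinh² 4`, whose integral is at most
`1/4`; hence `|G z| ≥ (3/4) |z| ≥ 3`. -/
theorem three_le_norm_haagerupLift {s : ℝ} (hs : |s| ≤ Real.pi / 2) :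
    3 ≤ ‖haagerupLift (s + (4 : ℝ) * Complex.I)‖ := by
  set z : ℂ := s + (4 : ℝ) * Complex.I with hz
  have hzre : z.re = s := by simp [hz]
  have hzim : z.im = 4 := by simp [hz]
  have hz' : |z.re| ≤ Real.pi / 2 := by rwa [hzre]
  have hz4 : 4 ≤ ‖z‖ := by
    have := Complex.abs_im_le_norm z
    rwa [hzim, abs_of_pos (by norm_num : (0 : ℝ) < 4)] at this
  have hsh : (4 : ℝ) ≤ Real.sinh 4 := Real.self_le_sinh_iff.2 (by norm_num)
  have hsin : Real.sinh 4 ^ 2 ≤ ‖Complex.sin z‖ ^ 2 := by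
    rw [Complex.sq_norm_sin, hzim]; linarith [sq_nonneg (Real.sin z.re)]
  have hi := intervalIntegrable_haagerupLiftIntegrand hz'
  have hcosh : ∫ r in (0 : ℝ)..1, Real.cosh (r * 4) ^ 2 / Real.sinh 4 ^ 2
      = (1 / 2 + Real.sinh 8 / 16) / Real.sinh 4 ^ 2 := by
    rw [intervalIntegral.integral_div]
    congr 1
    rw [intervalIntegral.integral_eq_sub_of_hasDerivAt
      (f := fun r => r / 2 + Real.sinh (8 * r) / 16) (fun r _ => ?_)
      (Continuous.intervalIntegrable (by fun_prop) _ _)]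
    · simp
    · have h := ((hasDerivAt_id r).div_const 2).add
        ((((hasDerivAt_id r).const_mul (8 : ℝ)).sinh).div_const 16)
      refine h.congr_deriv ?_
      have := Real.cosh_two_mul (r * 4)
      have h8 : 2 * (r * 4) = 8 * r := by ring
      rw [h8, Real.sinh_sq] at this
      simp only [id]
      linarith
  have hle : ‖(1 : ℂ) - ∫ r in (0 : ℝ)..1, haagerupLiftIntegrand z r‖ ≤ 1 / 4 := by
    have h1 : (1 : ℂ) - ∫ r in (0 : ℝ)..1, haagerupLiftIntegrand z r
        = ∫ r in (0 : ℝ)..1, (1 - haagerupLiftIntegrand z r) := by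
      rw [intervalIntegral.integral_sub intervalIntegrable_const hi]; simp
    rw [h1]
    refine (intervalIntegral.norm_integral_le_of_norm_le zero_le_one
      (g := fun r => Real.cosh (r * 4) ^ 2 / Real.sinh 4 ^ 2) ?_
      (Continuous.intervalIntegrable (by fun_prop) _ _)).trans ?_
    · refine Eventually.of_forall fun r hr => ?_
      refine (Complex.norm_one_sub_cpow_half_le _).trans ?_
      rw [norm_pow, norm_div, div_pow]
      have h2 := Complex.norm_sin_le_cosh_im (r * z)
      rw [Complex.im_ofReal_mul, hzim] at h2
      gcongr
    · rw [hcosh, div_le_iff₀ (by positivity)]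
      have h8 := Real.cosh_two_mul 4
      rw [Real.cosh_sq] at h8
      norm_num at h8
      have := Real.sinh_lt_cosh 8
      nlinarith
  have hone : 3 / 4 ≤ ‖∫ r in (0 : ℝ)..1, haagerupLiftIntegrand z r‖ := by
    have := norm_sub_norm_le (1 : ℂ) (1 - ∫ r in (0 : ℝ)..1, haagerupLiftIntegrand z r)
    rw [sub_sub_cancel, norm_one] at this
    linarith
  rw [haagerupLift, norm_mul]
  nlinarith

theorem norm_integral_top_le (n : ℕ) :
    ‖∫ s in (0 : ℝ)..(Real.pi / 2), Complex.cos (s + (4 : ℝ) * Complex.I)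
      * (haagerupLift (s + (4 : ℝ) * Complex.I) ^ n)⁻¹‖ ≤ 45 * (3 ^ n)⁻¹ := by
  have hcosh : Real.cosh 4 ≤ 28 := by
    rw [Real.cosh_eq]
    have h1 : Real.exp 4 ≤ 55 := by
      have := pow_le_pow_left₀ (Real.exp_pos 1).le Real.exp_one_lt_d9.le 4
      rw [← Real.exp_nat_mul] at this
      norm_num at this
      linarith
    have h2 : Real.exp (-4) ≤ 1 := Real.exp_le_one_iff.2 (by norm_num)
    linarith
  have h := intervalIntegral.norm_integral_le_of_norm_le_const (a := (0 : ℝ)) (b := Real.pi / 2)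
    (f := fun s : ℝ => Complex.cos (s + (4 : ℝ) * Complex.I)
      * (haagerupLift (s + (4 : ℝ) * Complex.I) ^ n)⁻¹) (C := 28 * (3 ^ n)⁻¹) fun s hs => by
    rw [uIoc_of_le (by positivity)] at hs
    have h3 := three_le_norm_haagerupLift (s := s) (by rw [abs_of_pos hs.1]; exact hs.2)
    rw [norm_mul, norm_inv, norm_pow]
    have hc : ‖Complex.cos (s + (4 : ℝ) * Complex.I)‖ ≤ 28 := by
      rw [← Complex.sin_add_pi_div_two]
      refine (Complex.norm_sin_le_cosh_im _).trans ?_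
      have : (s + (4 : ℝ) * Complex.I + Real.pi / 2 : ℂ).im = 4 := by
        rw [← Complex.ofReal_ofNat, ← Complex.ofReal_div]; simp
      rw [this]; exact hcosh
    gcongr
  refine h.trans ?_
  rw [sub_zero, abs_of_pos Real.pi_div_two_pos]
  have hp := Real.pi_lt_d4
  have : (0 : ℝ) ≤ (3 ^ n)⁻¹ := by positivity
  nlinarith

end top

/-! ### The real Haagerup function as a bijection of `[-1, 1]`. -/

section bijection

theorem realHaagerup_neg (x : ℝ) : realHaagerup (-x) = -realHaagerup x := by
  simp [realHaagerup]

theorem sq_cos_le_one_sub {x : ℝ} (hx : |x| ≤ 1) (t : ℝ) :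
    Real.cos t ^ 2 ≤ 1 - x ^ 2 * Real.sin t ^ 2 := by
  rw [Real.cos_sq']
  have := (sq_le_one_iff_abs_le_one x).2 hx
  nlinarith [sq_nonneg (Real.sin t)]

theorem realHaagerup_integrand_le {x t : ℝ} (hx : |x| ≤ 1) (ht : 0 ≤ Real.cos t) :
    Real.cos t ^ 2 / Real.sqrt (1 - x ^ 2 * Real.sin t ^ 2) ≤ Real.cos t := by
  refine div_le_of_le_mul₀ (Real.sqrt_nonneg _) ht ?_
  have := Real.le_sqrt_of_sq_le (sq_cos_le_one_sub hx t)
  nlinarith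

theorem cos_nonneg_of_mem {t : ℝ} (ht : t ∈ Icc 0 (Real.pi / 2)) : 0 ≤ Real.cos t :=
  Real.cos_nonneg_of_mem_Icc ⟨by linarith [ht.1, Real.pi_pos], ht.2⟩

theorem realHaagerup_integrand_norm_le {x t : ℝ} (hx : |x| ≤ 1)
    (ht : t ∈ Set.uIoc 0 (Real.pi / 2)) :
    ‖Real.cos t ^ 2 / Real.sqrt (1 - x ^ 2 * Real.sin t ^ 2)‖ ≤ 1 := by
  rw [uIoc_of_le Real.pi_div_two_pos.le] at ht
  rw [Real.norm_of_nonneg (by positivity)]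
  exact (realHaagerup_integrand_le hx (cos_nonneg_of_mem (Ioc_subset_Icc_self ht))).trans
    (Real.cos_le_one t)

theorem measurable_realHaagerup_integrand (x : ℝ) :
    Measurable fun t => Real.cos t ^ 2 / Real.sqrt (1 - x ^ 2 * Real.sin t ^ 2) := by
  fun_prop

theorem intervalIntegrable_realHaagerup {x : ℝ} (hx : |x| ≤ 1) :
    IntervalIntegrable (fun t => Real.cos t ^ 2 / Real.sqrt (1 - x ^ 2 * Real.sin t ^ 2))
      MeasureTheory.volume 0 (Real.pi / 2) := by
  refine IntervalIntegrable.mono_fun' (g := fun _ => (1 : ℝ)) intervalIntegrable_const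
    (measurable_realHaagerup_integrand x).aestronglyMeasurable ?_
  exact (MeasureTheory.ae_restrict_iff' measurableSet_uIoc).2
    (Eventually.of_forall fun t ht => realHaagerup_integrand_norm_le hx ht)

theorem continuousOn_realHaagerup : ContinuousOn realHaagerup (Icc (-1) 1) := by
  intro x hx
  refine continuousWithinAt_id.mul ?_
  refine intervalIntegral.continuousWithinAt_of_dominated_interval (bound := fun _ => (1 : ℝ))
    ?_ ?_ intervalIntegrable_const ?_
  · exact Eventually.of_forall fun w => (measurable_realHaagerup_integrand w).aestronglyMeasurable
  · filter_upwards [self_mem_nhdsWithin] with w hw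
    exact Eventually.of_forall fun t ht => realHaagerup_integrand_norm_le (abs_le.2 hw) ht
  · have h1 : ∀ᵐ t : ℝ, t ≠ Real.pi / 2 := by simp [MeasureTheory.ae_iff]
    filter_upwards [h1] with t ht hm
    rw [uIoc_of_le Real.pi_div_two_pos.le] at hm
    have hc : 0 < Real.cos t := Real.cos_pos_of_mem_Ioo
      ⟨by linarith [hm.1, Real.pi_pos], lt_of_le_of_ne hm.2 ht⟩
    have hp : 0 < 1 - x ^ 2 * Real.sin t ^ 2 :=
      lt_of_lt_of_le (by positivity) (sq_cos_le_one_sub (abs_le.2 hx) t)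
    refine ContinuousAt.continuousWithinAt ?_
    exact continuousAt_const.div (by fun_prop) (Real.sqrt_pos.2 hp).ne'

theorem integral_realHaagerup_mono {x y : ℝ} (hx : 0 ≤ x) (hxy : x ≤ y) (hy : y ≤ 1) :
    ∫ t in (0 : ℝ)..(Real.pi / 2), Real.cos t ^ 2 / Real.sqrt (1 - x ^ 2 * Real.sin t ^ 2)
      ≤ ∫ t in (0 : ℝ)..(Real.pi / 2), Real.cos t ^ 2 / Real.sqrt (1 - y ^ 2 * Real.sin t ^ 2) := by
  have hy' : |y| ≤ 1 := by rwa [abs_of_nonneg (hx.trans hxy)]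
  have hx' : |x| ≤ 1 := by rw [abs_of_nonneg hx]; exact hxy.trans hy
  refine intervalIntegral.integral_mono_on Real.pi_div_two_pos.le
    (intervalIntegrable_realHaagerup hx') (intervalIntegrable_realHaagerup hy') fun t ht => ?_
  rcases (sq_nonneg (Real.cos t)).eq_or_lt with h | h
  · rw [← h]; simp
  · have hp : 0 < 1 - y ^ 2 * Real.sin t ^ 2 := lt_of_lt_of_le h (sq_cos_le_one_sub hy' t)
    refine div_le_div_of_nonneg_left h.le (Real.sqrt_pos.2 hp) (Real.sqrt_le_sqrt ?_)
    gcongr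

theorem pi_div_four_le_integral_realHaagerup {x : ℝ} (hx : |x| ≤ 1) :
    Real.pi / 4
      ≤ ∫ t in (0 : ℝ)..(Real.pi / 2), Real.cos t ^ 2 / Real.sqrt (1 - x ^ 2 * Real.sin t ^ 2) := by
  have h0 := integral_realHaagerup_mono le_rfl (abs_nonneg x) hx
  have h : ∫ t in (0 : ℝ)..(Real.pi / 2), Real.cos t ^ 2 = Real.pi / 4 := by
    rw [integral_cos_sq]; simp only [Real.sin_zero, Real.cos_pi_div_two]; ring
  simpa [h] using h0

theorem realHaagerup_one : realHaagerup 1 = 1 := by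
  have h : ∫ t in (0 : ℝ)..(Real.pi / 2), Real.cos t = 1 := by simp
  rw [realHaagerup, one_mul]
  conv_rhs => rw [← h]
  refine intervalIntegral.integral_congr fun t ht => ?_
  rw [uIcc_of_le Real.pi_div_two_pos.le] at ht
  rw [one_pow, one_mul, ← Real.cos_sq', Real.sqrt_sq (cos_nonneg_of_mem ht), sq,
    mul_self_div_self]

theorem strictMonoOn_realHaagerup : StrictMonoOn realHaagerup (Icc (-1) 1) := by
  have hpos : ∀ x y : ℝ, 0 ≤ x → x < y → y ≤ 1 → realHaagerup x < realHaagerup y := by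
    intro x y hx hxy hy
    have h1 := integral_realHaagerup_mono hx hxy.le hy
    have h2 := pi_div_four_le_integral_realHaagerup (x := y)
      (by rwa [abs_of_nonneg (hx.trans hxy.le)])
    have h3 := Real.pi_pos
    exact (mul_le_mul_of_nonneg_left h1 hx).trans_lt
      (mul_lt_mul_of_pos_right hxy (by linarith))
  have h0 : realHaagerup 0 = 0 := by simp [realHaagerup]
  intro x hx y hy hxy
  rcases le_or_gt 0 x with h | h
  · exact hpos x y h hxy hy.2
  · rcases le_or_gt y 0 with h' | h'
    · have := hpos (-y) (-x) (by linarith) (by linarith) (by linarith [hx.1])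
      rw [realHaagerup_neg, realHaagerup_neg] at this
      linarith
    · have h1 := hpos 0 (-x) le_rfl (by linarith) (by linarith [hx.1])
      have h2 := hpos 0 y le_rfl h' hy.2
      rw [realHaagerup_neg] at h1
      linarith

theorem bijOn_realHaagerup : BijOn realHaagerup (Icc (-1) 1) (Icc (-1) 1) := by
  have h1 := realHaagerup_one
  have h2 : realHaagerup (-1) = -1 := by rw [realHaagerup_neg, h1]
  refine ⟨fun x hx => ?_, strictMonoOn_realHaagerup.injOn, ?_⟩
  · have hm := strictMonoOn_realHaagerup.monotoneOn
    constructor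
    · rw [← h2]; exact hm (by simp) hx hx.1
    · rw [← h1]; exact hm hx (by simp) hx.2
  · have := intermediate_value_Icc (by norm_num : (-1 : ℝ) ≤ 1) continuousOn_realHaagerup
    rwa [h1, h2] at this

theorem realHaagerupInv_realHaagerup {x : ℝ} (hx : x ∈ Icc (-1 : ℝ) 1) :
    realHaagerupInv (realHaagerup x) = x :=
  bijOn_realHaagerup.injOn.leftInvOn_invFunOn hx

theorem realHaagerup_realHaagerupInv {y : ℝ} (hy : y ∈ Icc (-1 : ℝ) 1) :
    realHaagerup (realHaagerupInv y) = y :=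
  bijOn_realHaagerup.surjOn.rightInvOn_invFunOn hy

theorem realHaagerupInv_mem {y : ℝ} (hy : y ∈ Icc (-1 : ℝ) 1) :
    realHaagerupInv y ∈ Icc (-1 : ℝ) 1 :=
  bijOn_realHaagerup.surjOn.mapsTo_invFunOn hy

theorem realHaagerupInv_neg {y : ℝ} (hy : y ∈ Icc (-1 : ℝ) 1) :
    realHaagerupInv (-y) = -realHaagerupInv y := by
  have h := realHaagerupInv_mem hy
  have := realHaagerupInv_realHaagerup (x := -realHaagerupInv y)
    ⟨by linarith [h.2], by linarith [h.1]⟩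
  rwa [realHaagerup_neg, realHaagerup_realHaagerupInv hy] at this

theorem mul_abs_le_abs_realHaagerup {x : ℝ} (hx : |x| ≤ 1) :
    Real.pi / 4 * |x| ≤ |realHaagerup x| := by
  have h := pi_div_four_le_integral_realHaagerup hx
  rw [realHaagerup, abs_mul, mul_comm]
  exact mul_le_mul_of_nonneg_left (h.trans (le_abs_self _)) (abs_nonneg x)

end bijection

/-! ### The expansion of the inverse, transported to the lift. -/

theorem haagerupLift_ofReal_eq {s : ℝ} (hs : |s| < Real.pi / 2) :
    haagerupLift s = realHaagerup (Real.sin s) := by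
  rcases lt_trichotomy s 0 with h | h | h
  · rw [abs_of_neg h] at hs
    have := haagerupLift_ofReal_eq_realHaagerup (s := -s) (by linarith) hs
    rw [Complex.ofReal_neg, haagerupLift_neg, Real.sin_neg, realHaagerup_neg,
      Complex.ofReal_neg] at this
    exact neg_injective this
  · subst h; simp [realHaagerup]
  · exact haagerupLift_ofReal_eq_realHaagerup h (by rwa [abs_of_pos h] at hs)

theorem analyticAt_haagerupLift {z : ℂ} (hz : |z.re| < Real.pi / 2) :
    AnalyticAt ℂ haagerupLift z := by
  have : DifferentiableOn ℂ haagerupLift {z : ℂ | |z.re| < Real.pi / 2} := fun w hw =>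
    (differentiableAt_haagerupLift hw).differentiableWithinAt
  exact this.analyticAt (isOpen_abs_re_lt.mem_nhds hz)

theorem exists_analyticAt_hasSum {c : ℕ → ℝ} {X : ℝ} (hX : 0 < X)
    (h : Summable fun j => c j * X ^ j) :
    ∃ f : ℂ → ℂ, AnalyticAt ℂ f 0 ∧
      ∀ w : ℂ, ‖w‖ < X → HasSum (fun j => (c j : ℂ) * w ^ j) (f w) := by
  set p := FormalMultilinearSeries.ofScalars ℂ (fun j => (c j : ℂ)) with hp
  have hr : (X.toNNReal : ENNReal) ≤ p.radius := by
    obtain ⟨M, hM⟩ := h.norm.tendsto_atTop_zero.bddAbove_range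
    refine p.le_radius_of_bound M fun j => ?_
    have h1 : ‖p j‖ = ‖c j‖ := by
      rw [hp, FormalMultilinearSeries.ofScalars_norm, Complex.norm_real]
    have h2 : ‖c j * X ^ j‖ ≤ M := hM ⟨j, rfl⟩
    rw [norm_mul, norm_pow, Real.norm_of_nonneg hX.le] at h2
    rwa [Real.coe_toNNReal _ hX.le, h1]
  have hr0 : 0 < p.radius := lt_of_lt_of_le (by simpa using hX) hr
  refine ⟨p.sum, (p.hasFPowerSeriesOnBall hr0).analyticAt, fun w hw => ?_⟩
  have hw' : w ∈ Metric.eball (0 : ℂ) p.radius := by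
    refine Metric.eball_subset_eball hr ?_
    rw [mem_eball_zero_iff, ← ofReal_norm]
    exact (ENNReal.ofReal_lt_ofReal_iff hX).2 hw
  have := (p.hasFPowerSeriesOnBall hr0).hasSum hw'
  simpa [hp, FormalMultilinearSeries.ofScalars_apply_eq, mul_comm] using this

theorem IsHaagerupInvExpansion.exists_summable {b : ℕ → ℝ} (hb : IsHaagerupInvExpansion b) :
    ∃ X : ℝ, 0 < X ∧ Summable fun j => b j * X ^ j := by
  obtain ⟨ε, hε, h⟩ := Metric.eventually_nhds_iff.1 hb
  have h1 := (h (y := ε / 2) (by rw [Real.dist_0_eq_abs, abs_of_pos] <;> linarith)).summable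
  -- The odd series in `x` is `x` times a series in `x²`, which is summable at the square of a point
  -- of convergence.
  refine ⟨(ε / 2) ^ 2, by positivity, ?_⟩
  have h2 := h1.mul_right (ε / 2)⁻¹
  refine h2.congr fun j => ?_
  rw [pow_succ, ← pow_mul]
  field_simp

/-- Near `0`, the expansion of the inverse inverts the lifted Haagerup function, and
the remainder after `k + 1` terms factors. -/
theorem IsHaagerupInvExpansion.exists_remainder {b : ℕ → ℝ} (hb : IsHaagerupInvExpansion b)
    (k : ℕ) : ∃ r : ℂ → ℂ, AnalyticAt ℂ r 0 ∧ ∀ᶠ z in 𝓝 (0 : ℂ),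
      Complex.sin z - ∑ j ∈ Finset.range (k + 1), (b j : ℂ) * haagerupLift z ^ (2 * j + 1)
        = haagerupLift z ^ (2 * k + 3) * r (haagerupLift z) := by
  obtain ⟨X, hX, hsum⟩ := hb.exists_summable
  have hsum' : Summable fun j => b (j + (k + 1)) * X ^ j := by
    have h1 := ((summable_nat_add_iff (k + 1)).2 hsum).mul_right (X ^ (k + 1))⁻¹
    refine h1.congr fun j => ?_
    rw [pow_add]
    field_simp
  obtain ⟨r, hr, hrs⟩ := exists_analyticAt_hasSum hX hsum'
  have hGan : AnalyticAt ℂ haagerupLift 0 :=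
    analyticAt_haagerupLift (by simpa using Real.pi_div_two_pos)
  have hGc : Tendsto haagerupLift (𝓝 0) (𝓝 0) := by simpa using hGan.continuousAt.tendsto
  have hran : AnalyticAt ℂ (fun w => r (w ^ 2)) 0 := by
    refine AnalyticAt.comp (g := r) (f := fun w : ℂ => w ^ 2) (by simpa using hr) ?_
    exact analyticAt_id.pow 2
  refine ⟨fun w => r (w ^ 2), hran, ?_⟩
  have hL : AnalyticAt ℂ (fun z => Complex.sin z
      - ∑ j ∈ Finset.range (k + 1), (b j : ℂ) * haagerupLift z ^ (2 * j + 1)) 0 := by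
    refine Complex.analyticAt_sin.sub ?_
    exact Finset.analyticAt_fun_sum _ fun j _ => analyticAt_const.mul (hGan.pow _)
  have hR : AnalyticAt ℂ (fun z => haagerupLift z ^ (2 * k + 3) * r (haagerupLift z ^ 2)) 0 :=
    (hGan.pow _).mul (AnalyticAt.comp (g := fun w => r (w ^ 2)) (f := haagerupLift)
      (by simpa using hran) hGan)
  -- Identity theorem: agreement on small positive reals, where the expansion applies to `h (sin
  -- s)`, is enough.
  refine (hL.frequently_eq_iff_eventually_eq hR).1 ?_
  have hreal : ∀ᶠ s : ℝ in 𝓝[>] 0, Complex.sin s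
      - ∑ j ∈ Finset.range (k + 1), (b j : ℂ) * haagerupLift s ^ (2 * j + 1)
        = haagerupLift s ^ (2 * k + 3) * r (haagerupLift s ^ 2) := by
    have h1 : Tendsto (fun s : ℝ => haagerupLift s) (𝓝[>] 0) (𝓝 0) :=
      hGc.comp (by simpa using (Complex.continuous_ofReal.tendsto 0).mono_left nhdsWithin_le_nhds)
    have h2 : Tendsto (fun s : ℝ => realHaagerup (Real.sin s)) (𝓝[>] 0) (𝓝 0) := by
      have h3 := (Complex.continuous_re.tendsto 0).comp h1
      rw [Complex.zero_re] at h3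
      refine h3.congr' ?_
      filter_upwards [Ioo_mem_nhdsGT Real.pi_div_two_pos] with s hs
      simp only [Function.comp]
      rw [haagerupLift_ofReal_eq_realHaagerup hs.1 hs.2, Complex.ofReal_re]
    have h4 : Tendsto (fun s : ℝ => ‖haagerupLift s ^ 2‖) (𝓝[>] 0) (𝓝 0) := by
      simpa using (h1.pow 2).norm
    filter_upwards [Ioo_mem_nhdsGT Real.pi_div_two_pos, h2.eventually hb,
      h4.eventually (gt_mem_nhds hX)] with s hs hs1 hs2
    have hsinm : Real.sin s ∈ Icc (-1 : ℝ) 1 := ⟨Real.neg_one_le_sin s, Real.sin_le_one s⟩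
    rw [realHaagerupInv_realHaagerup hsinm] at hs1
    have hG := haagerupLift_ofReal_eq_realHaagerup hs.1 hs.2
    have e1 : HasSum (fun j => (b j : ℂ) * haagerupLift s ^ (2 * j + 1)) (Complex.sin s) := by
      rw [hG, ← Complex.ofReal_sin]
      exact_mod_cast Complex.hasSum_ofReal.2 hs1
    have e2 := (hrs _ hs2).mul_left (haagerupLift s ^ (2 * k + 3))
    have e3 := (hasSum_nat_add_iff' (k + 1)).2 e1
    refine e3.unique (e2.congr_fun ?_)
    intro j
    ring
  have hmap : Tendsto (fun s : ℝ => (s : ℂ)) (𝓝[>] 0) (𝓝[≠] 0) := by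
    refine tendsto_nhdsWithin_iff.2 ⟨?_, ?_⟩
    · simpa using (Complex.continuous_ofReal.tendsto 0).mono_left nhdsWithin_le_nhds
    · filter_upwards [self_mem_nhdsWithin] with s hs
      simpa using (ne_of_gt hs)
  exact hmap.frequently hreal.frequently

/-! ### Reality on the axes and the contour integrand. -/

theorem im_haagerupLift_ofReal {s : ℝ} (hs : |s| ≤ Real.pi / 2) : (haagerupLift s).im = 0 := by
  rw [haagerupLift_ofReal hs, Complex.ofReal_im]

theorem re_haagerupLift_mul_I (y : ℝ) : (haagerupLift (y * Complex.I)).re = 0 := by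
  rw [haagerupLift_mul_I, Complex.re_ofReal_mul, Complex.I_re, mul_zero]

theorem im_deriv_haagerupLift_ofReal {s : ℝ} (hs : |s| < Real.pi / 2) :
    (deriv haagerupLift s).im = 0 := by
  have h1 := (differentiableAt_haagerupLift (z := s) (by simpa using hs)).hasDerivAt.comp_ofReal
  have h2 := Complex.imCLM.hasFDerivAt.comp_hasDerivAt s h1
  refine h2.unique ((hasDerivAt_const s (0 : ℝ)).congr_of_eventuallyEq ?_)
  filter_upwards [(isOpen_lt continuous_abs continuous_const).mem_nhds hs] with t ht
  exact im_haagerupLift_ofReal (le_of_lt ht)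

theorem im_deriv_haagerupLift_mul_I (y : ℝ) : (deriv haagerupLift (y * Complex.I)).im = 0 := by
  have h0 : HasDerivAt (fun t : ℝ => (t : ℂ) * Complex.I) Complex.I y := by
    simpa using (Complex.ofRealCLM.hasDerivAt (x := y)).mul_const Complex.I
  have h1 := (differentiableAt_haagerupLift (z := y * Complex.I)
    (by simpa using Real.pi_div_two_pos)).hasDerivAt.comp y h0
  have h2 := Complex.reCLM.hasFDerivAt.comp_hasDerivAt y h1
  have h3 := h2.unique ((hasDerivAt_const y (0 : ℝ)).congr_of_eventuallyEq
    (Eventually.of_forall fun t => re_haagerupLift_mul_I t))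
  simpa using h3

section contour
variable (b : ℕ → ℝ) (k : ℕ)

/-- The holomorphic function whose vanishing contour integral gives the coefficient formula. -/
noncomputable def contourIntegrand (z : ℂ) : ℂ :=
  (Complex.sin z - ∑ j ∈ Finset.range (k + 1), (b j : ℂ) * haagerupLift z ^ (2 * j + 1))
    * deriv haagerupLift z * (haagerupLift z ^ (2 * k + 2))⁻¹

/-- A primitive of `contourIntegrand` up to the term `cos z / haagerupLift z ^ (2 * k + 1)`. -/
noncomputable def contourPrimitive (z : ℂ) : ℂ :=
  -(Complex.sin z * (haagerupLift z ^ (2 * k + 1))⁻¹ / (2 * k + 1 : ℕ))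
    - (∑ j ∈ Finset.range k, (b j : ℂ) * ((haagerupLift z ^ (2 * (k - j)))⁻¹
      / (-(2 * (k - j) : ℕ) : ℂ)) + b k * Complex.log (haagerupLift z))

variable {b k}

theorem hasDerivAt_contourPrimitive {z : ℂ} (hz : |z.re| < Real.pi / 2) (hz0 : z ≠ 0)
    (hre : 0 ≤ z.re) : HasDerivAt (contourPrimitive b k)
      (contourIntegrand b k z
        - Complex.cos z * (haagerupLift z ^ (2 * k + 1))⁻¹ / (2 * k + 1 : ℕ)) z := by
  have hG := (differentiableAt_haagerupLift hz).hasDerivAt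
  have hne := haagerupLift_ne_zero hz.le hz0
  have hlog := hG.clog (haagerupLift_mem_slitPlane hz.le hz0 hre)
  have hpow : ∀ p : ℕ, HasDerivAt (fun z => (haagerupLift z ^ p)⁻¹)
      (-(p * (haagerupLift z ^ (p + 1))⁻¹ * deriv haagerupLift z)) z := fun p => by
    refine ((hG.pow p).inv (pow_ne_zero p hne)).congr_deriv ?_
    rcases p with - | p
    · simp
    · simp only [Nat.add_sub_cancel, Pi.pow_apply]
      field_simp
      ring
  have h1 := (((Complex.hasDerivAt_sin z).mul (hpow (2 * k + 1))).div_const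
    ((2 * k + 1 : ℕ) : ℂ)).neg
  have h2 := HasDerivAt.fun_sum (u := Finset.range k) fun j _ =>
    ((hpow (2 * (k - j))).div_const (-(2 * (k - j) : ℕ) : ℂ)).const_mul (b j : ℂ)
  refine (h1.sub (h2.add (hlog.const_mul (b k : ℂ)))).congr_deriv ?_
  have hterm : ∀ j ∈ Finset.range k, (b j : ℂ) * (-(((2 * (k - j) : ℕ) : ℂ)
      * (haagerupLift z ^ (2 * (k - j) + 1))⁻¹ * deriv haagerupLift z)
        / (-(2 * (k - j) : ℕ) : ℂ))
      = (b j : ℂ) * haagerupLift z ^ (2 * j + 1) * deriv haagerupLift z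
        * (haagerupLift z ^ (2 * k + 2))⁻¹ := by
    intro j hj
    have hjk := Finset.mem_range.1 hj
    have h0 : ((2 * (k - j) : ℕ) : ℂ) ≠ 0 := by
      rw [Nat.cast_ne_zero]; omega
    have e : 2 * k + 2 = (2 * (k - j) + 1) + (2 * j + 1) := by omega
    rw [e]
    field_simp
    ring
  rw [Finset.sum_congr rfl hterm, contourIntegrand, Finset.sum_range_succ, sub_mul, sub_mul,
    add_mul, add_mul, Finset.sum_mul, Finset.sum_mul]
  have hn : ((2 * k + 1 : ℕ) : ℂ) ≠ 0 := Nat.cast_ne_zero.2 (by omega)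
  have hlast : (b k : ℂ) * haagerupLift z ^ (2 * k + 1) * deriv haagerupLift z
      * (haagerupLift z ^ (2 * k + 2))⁻¹ = b k * (deriv haagerupLift z / haagerupLift z) := by
    rw [pow_succ (haagerupLift z) (2 * k + 1)]
    field_simp
  rw [hlast]
  field_simp
  ring

/-- At `0` the numerator is divisible by `G ^ (2k+3)`, which cancels the pole. Subtracting the
partial sum thus allows a rectangle with a corner at `0`, with no indentation. -/
theorem differentiableAt_contourIntegrand (hb : IsHaagerupInvExpansion b) {z : ℂ}
    (hz : |z.re| < Real.pi / 2) : DifferentiableAt ℂ (contourIntegrand b k) z := by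
  have hGan := analyticAt_haagerupLift hz
  by_cases hz0 : z = 0
  · subst hz0
    obtain ⟨r, hr, hev⟩ := hb.exists_remainder k
    have h0 : contourIntegrand b k =ᶠ[𝓝 0]
        fun z => haagerupLift z * r (haagerupLift z) * deriv haagerupLift z := by
      filter_upwards [hev] with z hz
      rw [contourIntegrand, hz]
      by_cases hG : haagerupLift z = 0
      · simp [hG]
      · rw [show 2 * k + 3 = 1 + (2 * k + 2) by ring, pow_add]
        field_simp
    refine DifferentiableAt.congr_of_eventuallyEq ?_ h0
    refine DifferentiableAt.mul (DifferentiableAt.mul hGan.differentiableAt ?_)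
      hGan.deriv.differentiableAt
    exact (AnalyticAt.comp (g := r) (f := haagerupLift) (by simpa using hr) hGan).differentiableAt
  · have hne := haagerupLift_ne_zero hz.le hz0
    have hG := hGan.differentiableAt
    refine DifferentiableAt.mul (DifferentiableAt.mul ?_ hGan.deriv.differentiableAt)
      ((hG.pow _).inv (pow_ne_zero _ hne))
    refine Complex.differentiableAt_sin.sub ?_
    exact DifferentiableAt.fun_sum fun j _ => (hG.pow _).const_mul _

theorem exists_eq_ofReal_of_im_eq_zero {w : ℂ} (h : w.im = 0) : ∃ x : ℝ, w = x :=
  ⟨w.re, Complex.ext rfl (by simpa using h)⟩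

theorem exists_eq_ofReal_mul_I_of_re_eq_zero {w : ℂ} (h : w.re = 0) :
    ∃ x : ℝ, w = x * Complex.I :=
  ⟨w.im, Complex.ext (by simpa using h) (by simp)⟩

theorem ofReal_mul_I_pow_even (x : ℝ) (p : ℕ) :
    ((x : ℂ) * Complex.I) ^ (2 * p) = (((-(x ^ 2)) ^ p : ℝ) : ℂ) := by
  rw [pow_mul, mul_pow, Complex.I_sq]; push_cast; ring

theorem im_contourIntegrand_ofReal {s : ℝ} (hs : |s| < Real.pi / 2) :
    (contourIntegrand b k s).im = 0 := by
  obtain ⟨p, hp⟩ := exists_eq_ofReal_of_im_eq_zero (im_haagerupLift_ofReal hs.le)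
  obtain ⟨q, hq⟩ := exists_eq_ofReal_of_im_eq_zero (im_deriv_haagerupLift_ofReal hs)
  rw [contourIntegrand, hp, hq]
  have : (Complex.sin s - ∑ j ∈ Finset.range (k + 1), (b j : ℂ) * (p : ℂ) ^ (2 * j + 1)) * q
      * ((p : ℂ) ^ (2 * k + 2))⁻¹
      = (((Real.sin s - ∑ j ∈ Finset.range (k + 1), b j * p ^ (2 * j + 1)) * q
      * (p ^ (2 * k + 2))⁻¹ : ℝ) : ℂ) := by push_cast; rfl
  rw [this, Complex.ofReal_im]

theorem re_contourIntegrand_mul_I (y : ℝ) : (contourIntegrand b k (y * Complex.I)).re = 0 := by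
  obtain ⟨p, hp⟩ := exists_eq_ofReal_mul_I_of_re_eq_zero (re_haagerupLift_mul_I y)
  obtain ⟨q, hq⟩ := exists_eq_ofReal_of_im_eq_zero (im_deriv_haagerupLift_mul_I y)
  rw [contourIntegrand, hp, hq, Complex.sin_mul_I, ← Complex.ofReal_sinh]
  have h1 : ∀ j, (b j : ℂ) * ((p : ℂ) * Complex.I) ^ (2 * j + 1)
      = ((b j * (-(p ^ 2)) ^ j * p : ℝ) : ℂ) * Complex.I := fun j => by
    rw [pow_succ, ofReal_mul_I_pow_even]; push_cast; ring
  simp only [h1]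
  rw [show 2 * k + 2 = 2 * (k + 1) by ring, ofReal_mul_I_pow_even, ← Finset.sum_mul, ← sub_mul,
    ← Complex.ofReal_sum, ← Complex.ofReal_sub, ← Complex.ofReal_inv, Complex.re_mul_ofReal,
    Complex.re_mul_ofReal, Complex.re_ofReal_mul, Complex.I_re]
  simp

theorem haagerupLift_ofReal_pos {s : ℝ} (hs : 0 < s) (hs' : s ≤ Real.pi / 2) :
    ∃ p : ℝ, 0 < p ∧ haagerupLift s = p := by
  obtain ⟨p, hp⟩ := exists_eq_ofReal_of_im_eq_zero
    (im_haagerupLift_ofReal (s := s) (by rwa [abs_of_pos hs]))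
  refine ⟨p, ?_, hp⟩
  have h := re_integral_haagerupLiftIntegrand_pos (z := s) (by simpa [abs_of_pos hs] using hs')
    (by exact_mod_cast hs.ne')
  have h2 := congrArg Complex.re hp
  rw [haagerupLift, Complex.re_ofReal_mul, Complex.ofReal_re] at h2
  rw [← h2]; positivity

theorem haagerupLift_mul_I_pos {y : ℝ} (hy : 0 < y) :
    ∃ p : ℝ, 0 < p ∧ haagerupLift (y * Complex.I) = p * Complex.I := by
  obtain ⟨p, hp⟩ := exists_eq_ofReal_mul_I_of_re_eq_zero (re_haagerupLift_mul_I y)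
  refine ⟨p, ?_, hp⟩
  have h := re_integral_haagerupLiftIntegrand_pos (z := y * Complex.I)
    (by simpa using Real.pi_div_two_pos.le) (by simpa using hy.ne')
  have h2 := congrArg Complex.im hp
  rw [haagerupLift, mul_assoc, Complex.im_ofReal_mul, Complex.im_ofReal_mul, Complex.I_im,
    mul_one, Complex.I_mul_im] at h2
  rw [← h2]; positivity

theorem im_contourPrimitive_ofReal {s : ℝ} (hs : 0 < s) (hs' : s ≤ Real.pi / 2) :
    (contourPrimitive b k s).im = 0 := by
  obtain ⟨p, hp, hG⟩ := haagerupLift_ofReal_pos hs hs'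
  rw [contourPrimitive, hG, ← Complex.ofReal_log hp.le]
  have : (-(Complex.sin s * ((p : ℂ) ^ (2 * k + 1))⁻¹ / (2 * k + 1 : ℕ))
    - (∑ j ∈ Finset.range k, (b j : ℂ) * (((p : ℂ) ^ (2 * (k - j)))⁻¹
      / (-(2 * (k - j) : ℕ) : ℂ)) + b k * (Real.log p : ℂ)))
      = ((-(Real.sin s * (p ^ (2 * k + 1))⁻¹ / (2 * k + 1 : ℕ))
    - (∑ j ∈ Finset.range k, b j * ((p ^ (2 * (k - j)))⁻¹
      / (-(2 * (k - j) : ℕ) : ℝ)) + b k * Real.log p) : ℝ) : ℂ) := by push_cast; rfl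
  rw [this, Complex.ofReal_im]

/-- The powers of `G` in the primitive contribute real numbers here. Only `b k * log G` has an
imaginary part, since `G` has argument `π/2`; on the real axis it has argument `0`. This jump is
what isolates `b k`. -/
theorem im_contourPrimitive_mul_I {y : ℝ} (hy : 0 < y) :
    (contourPrimitive b k (y * Complex.I)).im = -(b k * (Real.pi / 2)) := by
  obtain ⟨p, hp, hG⟩ := haagerupLift_mul_I_pos hy
  have hlog : (Complex.log (p * Complex.I)).im = Real.pi / 2 := by
    rw [Complex.log_im, Complex.arg_real_mul _ hp, Complex.arg_I]
  have h1 : Complex.sin (y * Complex.I) * (((p : ℂ) * Complex.I) ^ (2 * k + 1))⁻¹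
      / (2 * k + 1 : ℕ) = ((Real.sinh y * ((-(p ^ 2)) ^ k * p)⁻¹ / (2 * k + 1 : ℕ) : ℝ) : ℂ) := by
    rw [pow_succ, ofReal_mul_I_pow_even, Complex.sin_mul_I]
    push_cast
    have := Complex.I_ne_zero
    rw [← mul_assoc, mul_inv _ Complex.I]
    field_simp
  have h2 : ∑ j ∈ Finset.range k, (b j : ℂ) * ((((p : ℂ) * Complex.I) ^ (2 * (k - j)))⁻¹
      / (-(2 * (k - j) : ℕ) : ℂ))
      = ((∑ j ∈ Finset.range k, b j * (((-(p ^ 2)) ^ (k - j))⁻¹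
      / (-(2 * (k - j) : ℕ) : ℝ)) : ℝ) : ℂ) := by
    simp only [ofReal_mul_I_pow_even]
    push_cast; rfl
  rw [contourPrimitive, hG, h1, h2, Complex.sub_im, Complex.add_im, Complex.neg_im,
    Complex.ofReal_im, Complex.ofReal_im, Complex.im_ofReal_mul, hlog]
  ring

end contour

/-! ### The coefficient formula and the sign for large index. -/

section coefficient
variable {b : ℕ → ℝ} {k : ℕ}

theorem differentiableAt_cos_mul_inv_haagerupLift_pow (n : ℕ) {z : ℂ} (hz : |z.re| < Real.pi / 2)
    (hz0 : z ≠ 0) :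
    DifferentiableAt ℂ (fun z => Complex.cos z * (haagerupLift z ^ n)⁻¹) z :=
  Complex.differentiableAt_cos.mul (((differentiableAt_haagerupLift hz).pow n).inv
    (pow_ne_zero n (haagerupLift_ne_zero hz.le hz0)))

theorem continuousOn_cos_mul_inv_haagerupLift_pow (n : ℕ) :
    ContinuousOn (fun z => Complex.cos z * (haagerupLift z ^ n)⁻¹)
      {z : ℂ | |z.re| ≤ Real.pi / 2 ∧ z ≠ 0} :=
  Complex.continuous_cos.continuousOn.mul
    (((continuousOn_haagerupLift.mono fun _ hz => hz.1).pow n).inv₀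
      fun _ hz => pow_ne_zero n (haagerupLift_ne_zero hz.1 hz.2))

theorem im_cos_mul_inv_haagerupLift_pow_ofReal (n : ℕ) {s : ℝ} (hs : |s| ≤ Real.pi / 2) :
    (Complex.cos s * (haagerupLift s ^ n)⁻¹).im = 0 := by
  obtain ⟨p, hp⟩ := exists_eq_ofReal_of_im_eq_zero (im_haagerupLift_ofReal hs)
  rw [hp, ← Complex.ofReal_cos, ← Complex.ofReal_pow, ← Complex.ofReal_inv, ← Complex.ofReal_mul,
    Complex.ofReal_im]

/-- The primitive evaluated along horizontal and vertical segments of the quadrant. -/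
theorem integral_contourIntegrand_segment (hb : IsHaagerupInvExpansion b) {z₀ v : ℂ} {p q : ℝ}
    (hseg : ∀ t ∈ uIcc p q, |(z₀ + t * v).re| < Real.pi / 2 ∧ z₀ + t * v ≠ 0 ∧ 0 ≤ (z₀ + t * v).re) :
    v * ∫ t in p..q, contourIntegrand b k (z₀ + t * v)
      = contourPrimitive b k (z₀ + q * v) - contourPrimitive b k (z₀ + p * v)
        + v * (∫ t in p..q, Complex.cos (z₀ + t * v)
          * (haagerupLift (z₀ + t * v) ^ (2 * k + 1))⁻¹) / (2 * k + 1 : ℕ) := by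
  have hcD : ContinuousOn (fun t : ℝ => contourIntegrand b k (z₀ + t * v)) (uIcc p q) :=
    fun t ht => ContinuousAt.continuousWithinAt <| ContinuousAt.comp
      (f := fun t : ℝ => z₀ + t * v) (g := contourIntegrand b k)
      (differentiableAt_contourIntegrand hb (hseg t ht).1).continuousAt (by fun_prop)
  have hcf : ContinuousOn (fun t : ℝ => Complex.cos (z₀ + t * v)
      * (haagerupLift (z₀ + t * v) ^ (2 * k + 1))⁻¹) (uIcc p q) :=
    fun t ht => ContinuousAt.continuousWithinAt <| ContinuousAt.comp
      (f := fun t : ℝ => z₀ + t * v)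
      (g := fun z => Complex.cos z * (haagerupLift z ^ (2 * k + 1))⁻¹)
      (differentiableAt_cos_mul_inv_haagerupLift_pow _ (hseg t ht).1
        (hseg t ht).2.1).continuousAt (by fun_prop)
  have hderiv : ∀ t ∈ uIcc p q, HasDerivAt (fun t : ℝ => contourPrimitive b k (z₀ + t * v))
      ((contourIntegrand b k (z₀ + t * v) - Complex.cos (z₀ + t * v)
        * (haagerupLift (z₀ + t * v) ^ (2 * k + 1))⁻¹ / (2 * k + 1 : ℕ)) * v) t := fun t ht => by
    have h1 : HasDerivAt (fun t : ℝ => z₀ + (t : ℂ) * v) v t := by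
      simpa using ((Complex.ofRealCLM.hasDerivAt (x := t)).mul_const v).const_add z₀
    exact (hasDerivAt_contourPrimitive (hseg t ht).1 (hseg t ht).2.1 (hseg t ht).2.2).comp t h1
  have hint := intervalIntegral.integral_eq_sub_of_hasDerivAt hderiv
    ((hcD.sub (hcf.div_const _)).mul continuousOn_const).intervalIntegrable
  rw [intervalIntegral.integral_mul_const, intervalIntegral.integral_sub hcD.intervalIntegrable
    (hcf.div_const _).intervalIntegrable, intervalIntegral.integral_div] at hint
  rw [← hint]; ring

/-- Cauchy's theorem for `contourIntegrand`: the edges on the axes contribute nothing to the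
imaginary part, and the other two are evaluated by `contourPrimitive`. Here `a < π/2` because the
derivative of the lift is only controlled in the open strip. -/
theorem coefficient_eq_im_contour_of_lt (hb : IsHaagerupInvExpansion b) {a Y : ℝ} (ha : 0 < a)
    (ha' : a < Real.pi / 2) (hY : 0 < Y) :
    (2 * k + 1 : ℕ) * b k * (Real.pi / 2)
      = (Complex.I * ∫ y in (0 : ℝ)..Y, Complex.cos (a + y * Complex.I)
          * (haagerupLift (a + y * Complex.I) ^ (2 * k + 1))⁻¹).im
        - (∫ s in (0 : ℝ)..a, Complex.cos (s + Y * Complex.I)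
          * (haagerupLift (s + Y * Complex.I) ^ (2 * k + 1))⁻¹).im := by
  have hcau := Complex.integral_boundary_rect_eq_zero_of_differentiableOn (contourIntegrand b k)
    0 (a + Y * Complex.I) fun z hz => by
      refine (differentiableAt_contourIntegrand hb ?_).differentiableWithinAt
      have h1 : z.re ∈ uIcc 0 a := by simpa using hz.1
      rw [uIcc_of_le ha.le] at h1
      rw [abs_of_nonneg h1.1]; exact h1.2.trans_lt ha'
  simp only [Complex.zero_re, Complex.zero_im, Complex.add_re, Complex.add_im, Complex.ofReal_re,
    Complex.ofReal_im, Complex.re_ofReal_mul, Complex.im_ofReal_mul, Complex.I_re, Complex.I_im,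
    mul_zero, mul_one, add_zero, zero_add, Complex.ofReal_zero, zero_mul, smul_eq_mul] at hcau
  have hright := integral_contourIntegrand_segment (k := k) hb (z₀ := a) (v := Complex.I) (p := 0)
    (q := Y) fun t _ => by
      refine ⟨by simpa [abs_of_pos ha] using ha', fun h => ?_, by simpa using ha.le⟩
      have := congrArg Complex.re h
      simp at this; exact ha.ne' this
  have htop := integral_contourIntegrand_segment (k := k) hb (z₀ := Y * Complex.I) (v := 1) (p := 0)
    (q := a) fun t ht => by
      rw [uIcc_of_le ha.le] at ht
      refine ⟨by simpa [abs_of_nonneg ht.1] using ht.2.trans_lt ha', fun h => ?_,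
        by simpa using ht.1⟩
      have := congrArg Complex.im h
      simp at this; exact hY.ne' this
  simp only [mul_one, one_mul, add_comm ((Y : ℂ) * Complex.I), Complex.ofReal_zero, zero_mul,
    add_zero, zero_add] at htop hright
  have hcont : ∀ w v : ℂ, ∀ p q : ℝ, (∀ t ∈ uIcc p q, |(w + t * v).re| < Real.pi / 2) →
      IntervalIntegrable (fun t : ℝ => contourIntegrand b k (w + t * v)) MeasureTheory.volume p q :=
    fun w v p q h => ContinuousOn.intervalIntegrable fun t ht =>
      ContinuousAt.continuousWithinAt <| ContinuousAt.comp (f := fun t : ℝ => w + t * v)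
        (g := contourIntegrand b k)
        (differentiableAt_contourIntegrand hb (h t ht)).continuousAt (by fun_prop)
  have hbot : (∫ x in (0 : ℝ)..a, contourIntegrand b k x).im = 0 := by
    have hi := hcont 0 1 0 a fun t ht => by
      rw [uIcc_of_le ha.le] at ht
      simpa [abs_of_nonneg ht.1] using ht.2.trans_lt ha'
    simp only [zero_add, mul_one] at hi
    refine (Complex.imCLM.intervalIntegral_comp_comm hi).symm.trans ?_
    rw [intervalIntegral.integral_congr (g := fun _ => (0 : ℝ)) fun t ht => ?_]
    · simp
    · rw [uIcc_of_le ha.le] at ht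
      exact im_contourIntegrand_ofReal (by rw [abs_of_nonneg ht.1]; exact ht.2.trans_lt ha')
  have hleft : (Complex.I * ∫ y in (0 : ℝ)..Y, contourIntegrand b k (y * Complex.I)).im = 0 := by
    have hi := hcont 0 Complex.I 0 Y fun t ht => by simpa using Real.pi_div_two_pos
    simp only [zero_add] at hi
    rw [Complex.I_mul_im]
    refine (Complex.reCLM.intervalIntegral_comp_comm hi).symm.trans ?_
    rw [intervalIntegral.integral_congr (g := fun _ => (0 : ℝ)) fun t _ => ?_]
    · simp
    · exact re_contourIntegrand_mul_I t
  rw [hright, htop] at hcau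
  have him := congrArg Complex.im hcau
  have hV1 := im_contourPrimitive_ofReal (b := b) (k := k) ha ha'.le
  have hV2 := im_contourPrimitive_mul_I (b := b) (k := k) hY
  simp only [Complex.add_im, Complex.sub_im, hbot, hleft, hV1, hV2, Complex.div_natCast_im,
    Complex.zero_im] at him
  have hn : ((2 * k + 1 : ℕ) : ℝ) ≠ 0 := Nat.cast_ne_zero.2 (by omega)
  field_simp at him ⊢
  linarith

/-- The coefficients of the inverse as integrals over the right and top edges of a rectangle. -/
theorem coefficient_eq_im_contour (hb : IsHaagerupInvExpansion b) {Y : ℝ} (hY : 0 < Y) :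
    (2 * k + 1 : ℕ) * b k * (Real.pi / 2)
      = (∫ y in (0 : ℝ)..Y, (Real.sinh y : ℂ)
          * (haagerupLift ((Real.pi / 2 : ℝ) + y * Complex.I) ^ (2 * k + 1))⁻¹).im
        - (∫ s in (0 : ℝ)..(Real.pi / 2), Complex.cos (s + Y * Complex.I)
          * (haagerupLift (s + Y * Complex.I) ^ (2 * k + 1))⁻¹).im := by
  -- Any `a` in `(0, π/2)` would do. The integrand `cos z / G ^ n`, free of the derivative of `G`,
  -- is continuous up to `Re z = π/2`, so Cauchy's theorem on `[a, π/2] × [0, Y]` moves the edge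
  -- there.
  set a : ℝ := Real.pi / 4 with ha
  have hpi := Real.pi_pos
  have ha0 : 0 < a := by positivity
  have ha2 : a < Real.pi / 2 := by rw [ha]; linarith
  have h1 := coefficient_eq_im_contour_of_lt (k := k) hb ha0 ha2 hY
  set f : ℂ → ℂ := fun z => Complex.cos z * (haagerupLift z ^ (2 * k + 1))⁻¹ with hf
  have hstrip : ∀ z : ℂ, z.re ∈ Icc a (Real.pi / 2) → |z.re| ≤ Real.pi / 2 ∧ z ≠ 0 := fun z hz => by
    refine ⟨by rw [abs_of_pos (ha0.trans_le hz.1)]; exact hz.2, fun h => ?_⟩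
    rw [h] at hz; exact absurd hz.1 (not_le.2 ha0)
  have hcau := Complex.integral_boundary_rect_eq_zero_of_continuousOn_of_differentiableOn f
    (a : ℂ) ((Real.pi / 2 : ℝ) + Y * Complex.I) ?_ ?_
  · simp only [Complex.add_re, Complex.add_im, Complex.ofReal_re,
      Complex.ofReal_im, Complex.re_ofReal_mul, Complex.im_ofReal_mul, Complex.I_re, Complex.I_im,
      mul_zero, mul_one, add_zero, zero_add, Complex.ofReal_zero, zero_mul, smul_eq_mul] at hcau
    have hfc := continuousOn_cos_mul_inv_haagerupLift_pow (2 * k + 1)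
    have hbot : (∫ x in a..(Real.pi / 2), f x).im = 0 := by
      have hi : IntervalIntegrable (fun x : ℝ => f x) MeasureTheory.volume a (Real.pi / 2) := by
        refine ContinuousOn.intervalIntegrable ?_
        refine hfc.comp (by fun_prop) fun x hx => ?_
        rw [uIcc_of_le ha2.le] at hx
        exact hstrip _ (by simpa using hx)
      refine (Complex.imCLM.intervalIntegral_comp_comm hi).symm.trans ?_
      rw [intervalIntegral.integral_congr (g := fun _ => (0 : ℝ)) fun t ht => ?_]
      · simp
      · rw [uIcc_of_le ha2.le] at ht
        exact im_cos_mul_inv_haagerupLift_pow_ofReal _ (hstrip t (by simpa using ht)).1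
    have htopi : ∀ p q : ℝ, 0 ≤ p → p ≤ q → q ≤ Real.pi / 2 →
        IntervalIntegrable (fun x : ℝ => f (x + Y * Complex.I)) MeasureTheory.volume p q :=
      fun p q hp hpq hq => by
        refine ContinuousOn.intervalIntegrable (hfc.comp (by fun_prop) fun x hx => ⟨?_, fun h => ?_⟩)
        · rw [uIcc_of_le hpq] at hx
          simpa [abs_of_nonneg (hp.trans hx.1)] using hx.2.trans hq
        · have := congrArg Complex.im h
          simp at this; exact hY.ne' this
    have hadd := intervalIntegral.integral_add_adjacent_intervals
      (htopi 0 a le_rfl ha0.le ha2.le) (htopi a (Real.pi / 2) ha0.le ha2.le le_rfl)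
    have hedge : Complex.I * ∫ y in (0 : ℝ)..Y, f ((Real.pi / 2 : ℝ) + y * Complex.I)
        = ∫ y in (0 : ℝ)..Y, (Real.sinh y : ℂ)
          * (haagerupLift ((Real.pi / 2 : ℝ) + y * Complex.I) ^ (2 * k + 1))⁻¹ := by
      rw [← intervalIntegral.integral_const_mul]
      refine intervalIntegral.integral_congr fun y _ => ?_
      simp only [hf, Complex.cos_pi_div_two_add_mul_I]
      linear_combination (-(Real.sinh y : ℂ)
        * (haagerupLift ((Real.pi / 2 : ℝ) + y * Complex.I) ^ (2 * k + 1))⁻¹) * Complex.I_sq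
    rw [hedge] at hcau
    have him := congrArg Complex.im hcau
    have hadd' := congrArg Complex.im hadd
    simp only [Complex.add_im, Complex.sub_im, hbot, Complex.zero_im] at him hadd'
    rw [h1]
    linarith
  · refine (continuousOn_cos_mul_inv_haagerupLift_pow _).mono fun z hz => hstrip z ?_
    have := hz.1
    simpa [uIcc_of_le ha2.le] using this
  · intro z hz
    have hzr : z.re ∈ Ioo a (Real.pi / 2) := by
      have := hz.1
      simpa [min_eq_left ha2.le, max_eq_right ha2.le] using this
    refine (differentiableAt_cos_mul_inv_haagerupLift_pow _ ?_
      (hstrip z ⟨hzr.1.le, hzr.2.le⟩).2).differentiableWithinAt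
    rw [abs_of_pos (ha0.trans hzr.1)]; exact hzr.2

theorem coefficient_nonpos_of_ten_le (hb : IsHaagerupInvExpansion b) (hk : 10 ≤ k) : b k ≤ 0 := by
  have h1 := coefficient_eq_im_contour (k := k) hb (Y := 4) (by norm_num)
  have h2 := im_integral_edge_le (n := 2 * k + 1) (by omega)
  have h3 := (Complex.abs_im_le_norm _).trans (norm_integral_top_le (2 * k + 1))
  have h4 := (abs_le.1 h3).1
  have hn : (0 : ℝ) < (2 * k + 1 : ℕ) := Nat.cast_pos.2 (by omega)
  have h5 : ((2 * k + 1 : ℕ) : ℝ) * b k * (Real.pi / 2) ≤ 0 := by rw [h1]; linarith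
  by_contra h
  have := mul_pos (mul_pos hn (not_le.1 h)) Real.pi_div_two_pos
  linarith

end coefficient

/-! ### Exact arithmetic for the low-order coefficients. -/

section lowOrder
open Asymptotics

/-- The integers `catalan j * centralBinom j` for `j < 10`. -/
def haagerupCoeff (j : ℕ) : ℤ :=
  [1, 2, 12, 100, 980, 10584, 121968, 1472328, 18404100, 236390440].getD j 0

/-- The coefficients of the powers of `∑ haagerupCoeff j * X ^ j`. -/
def haagerupPowCoeff : ℕ → ℕ → ℤ
  | 0, j => if j = 0 then 1 else 0
  | p + 1, j => ∑ i ∈ Finset.range (j + 1), haagerupPowCoeff p i * haagerupCoeff (j - i)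

/-- The normalized coefficients of the inverse Haagerup function of low order. -/
def haagerupInvCoeff (k : ℕ) : ℤ :=
  [1, -2, 0, -4, -20, -120, -784, -5448, -39636, -298760].getD k 0

theorem haagerupPowCoeff_zero_right (p : ℕ) : haagerupPowCoeff p 0 = 1 := by
  induction p with
  | zero => simp [haagerupPowCoeff]
  | succ p ih => simp [haagerupPowCoeff, ih, haagerupCoeff]

theorem sum_haagerupInvCoeff_mul : ∀ m < 10, ∑ k ∈ Finset.range (m + 1),
    haagerupInvCoeff k * haagerupPowCoeff (2 * k + 1) (m - k) = if m = 0 then 1 else 0 := by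
  decide +kernel

theorem haagerupInvCoeff_nonpos : ∀ k < 10, 1 ≤ k → haagerupInvCoeff k ≤ 0 := by decide

theorem haagerupCoeff_eq {j : ℕ} (hj : j < 10) :
    (haagerupCoeff j : ℝ) = (Nat.centralBinom j : ℝ) ^ 2 / (j + 1) := by
  have h : ∀ j < 10, haagerupCoeff j * (j + 1) = (Nat.centralBinom j : ℤ) ^ 2 := by
    decide +kernel
  rw [eq_div_iff (by positivity)]
  exact_mod_cast h j hj

/-- The triangular system satisfied by `haagerupInvCoeff` has a unique solution. -/
theorem eq_haagerupInvCoeff_of_system {β : ℕ → ℝ}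
    (h : ∀ m < 10, ∑ k ∈ Finset.range (m + 1), β k * (haagerupPowCoeff (2 * k + 1) (m - k) : ℝ)
      = if m = 0 then 1 else 0) : ∀ m < 10, β m = haagerupInvCoeff m := by
  intro m
  induction m using Nat.strong_induction_on with
  | _ m ih =>
    intro hm
    have h1 := h m hm
    have h2 : (∑ k ∈ Finset.range (m + 1), (haagerupInvCoeff k : ℝ)
        * (haagerupPowCoeff (2 * k + 1) (m - k) : ℝ)) = if m = 0 then 1 else 0 := by
      exact_mod_cast congrArg (Int.cast : ℤ → ℝ) (sum_haagerupInvCoeff_mul m hm)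
    rw [← h2, Finset.sum_range_succ, Finset.sum_range_succ, Nat.sub_self,
      haagerupPowCoeff_zero_right] at h1
    rw [Finset.sum_congr rfl fun k hk => by
      rw [ih k (Finset.mem_range.1 hk) (by have := Finset.mem_range.1 hk; omega)]] at h1
    simpa using h1

/-- The Taylor polynomial of `4 / π * h (4 √X) / (4 √X)`, where `h` is the Haagerup function. -/
noncomputable def haagerupPoly : Polynomial ℝ :=
  ∑ j ∈ Finset.range 10, Polynomial.C (haagerupCoeff j : ℝ) * Polynomial.X ^ j

theorem coeff_haagerupPoly_pow (p j : ℕ) (hj : j < 10) :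
    (haagerupPoly ^ p).coeff j = haagerupPowCoeff p j := by
  induction p generalizing j with
  | zero => simp [haagerupPowCoeff, Polynomial.coeff_one]
  | succ p ih =>
    have hc : ∀ i < 10, haagerupPoly.coeff i = haagerupCoeff i := fun i hi => by
      simp [haagerupPoly, Polynomial.coeff_X_pow, hi]
    rw [pow_succ, Polynomial.coeff_mul, Finset.Nat.sum_antidiagonal_eq_sum_range_succ
      (fun a c => (haagerupPoly ^ p).coeff a * haagerupPoly.coeff c), haagerupPowCoeff,
      Int.cast_sum]
    refine Finset.sum_congr rfl fun i hi => ?_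
    have := Finset.mem_range.1 hi
    rw [ih i (by omega), hc _ (by omega), Int.cast_mul]

/-- Transfers asymptotic estimates for `h` and its inverse to exact identities between coefficients.
-/
theorem Polynomial.coeff_eq_zero_of_isBigO {Q : Polynomial ℝ} {N : ℕ}
    (h : (fun w => Q.eval w) =O[𝓝[>] 0] fun w : ℝ => w ^ N) : ∀ i < N, Q.coeff i = 0 := by
  intro i
  induction i using Nat.strong_induction_on with
  | _ i ih =>
    intro hi
    obtain ⟨R, hR⟩ := Polynomial.X_pow_dvd_iff.2 fun d hd => ih d hd (hd.trans hi)
    have hcoeff : Q.coeff i = R.eval 0 := by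
      rw [hR, ← Polynomial.coeff_zero_eq_eval_zero]
      simpa using Polynomial.coeff_X_pow_mul R i 0
    have h1 : Tendsto (fun w => R.eval w) (𝓝[>] 0) (𝓝 (R.eval 0)) :=
      (R.continuous.tendsto 0).mono_left nhdsWithin_le_nhds
    have h2 : (fun w => R.eval w) =O[𝓝[>] 0] fun w : ℝ => w ^ (N - i) := by
      have h3 := h.mul (isBigO_refl (fun w : ℝ => (w ^ i)⁻¹) (𝓝[>] 0))
      refine h3.congr' ?_ ?_ <;> filter_upwards [self_mem_nhdsWithin] with w hw
      · have : w ≠ 0 := ne_of_gt hw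
        rw [hR]; simp only [Polynomial.eval_mul, Polynomial.eval_pow, Polynomial.eval_X]
        field_simp
      · have : w ≠ 0 := ne_of_gt hw
        rw [← Nat.sub_add_cancel hi.le, pow_add, Nat.add_sub_cancel]
        field_simp
    have h4 : Tendsto (fun w : ℝ => w ^ (N - i)) (𝓝[>] 0) (𝓝 0) := by
      have h5 : N - i ≠ 0 := by omega
      have := ((continuous_pow (N - i)).tendsto (0 : ℝ)).mono_left
        (nhdsWithin_le_nhds (s := Ioi 0))
      simpa [h5] using this
    rw [hcoeff]
    exact tendsto_nhds_unique h1 (h2.trans_tendsto h4)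

theorem Ring.choose_half_add_sub_one (n : ℕ) :
    Ring.choose ((1 / 2 : ℝ) + n - 1) n = Nat.centralBinom n / 4 ^ n := by
  rw [← Ring.multichoose_eq]
  have h := Ring.factorial_nsmul_multichoose_eq_ascPochhammer (1 / 2 : ℝ) n
  rw [Polynomial.ascPochhammer_smeval_eq_eval, nsmul_eq_mul] at h
  have hf : (n.factorial : ℝ) ≠ 0 := Nat.cast_ne_zero.2 n.factorial_ne_zero
  have h2 : (ascPochhammer ℝ n).eval (1 / 2) = n.factorial * (Nat.centralBinom n / 4 ^ n) := by
    clear h hf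
    induction n with
    | zero => simp
    | succ n ih =>
      have hcb : ((n : ℝ) + 1) * Nat.centralBinom (n + 1)
          = 2 * (2 * n + 1) * Nat.centralBinom n := by
        exact_mod_cast Nat.succ_mul_centralBinom_succ n
      rw [ascPochhammer_succ_eval, ih, Nat.factorial_succ, pow_succ]
      push_cast
      field_simp
      linear_combination -2 * hcb
  rw [h2] at h
  exact mul_left_cancel₀ hf h

theorem one_div_sqrt_one_sub_isBigO (N : ℕ) :
    (fun v : ℝ => 1 / Real.sqrt (1 - v)
      - ∑ j ∈ Finset.range N, (Nat.centralBinom j : ℝ) / 4 ^ j * v ^ j) =O[𝓝 0] fun v => v ^ N := by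
  have h := (Real.one_div_one_sub_rpow_hasFPowerSeriesOnBall_zero
    (1 / 2)).hasFPowerSeriesAt.isBigO_sub_partialSum_pow N
  refine IsBigO.trans (h.congr_left fun v => ?_) ?_
  · rw [zero_add, Real.sqrt_eq_rpow]
    congr 1
    simp only [FormalMultilinearSeries.partialSum, FormalMultilinearSeries.ofScalars_apply_eq,
      smul_eq_mul, Ring.choose_half_add_sub_one]
  · refine IsBigO.of_bound 1 (Eventually.of_forall fun v => ?_)
    simp

theorem integral_sin_pow_even_pi_div_two (j : ℕ) :
    ∫ t in (0 : ℝ)..(Real.pi / 2), Real.sin t ^ (2 * j)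
      = Real.pi / 2 * (Nat.centralBinom j / 4 ^ j) := by
  induction j with
  | zero => simp
  | succ j ih =>
    have hcb : ((j : ℝ) + 1) * Nat.centralBinom (j + 1)
        = 2 * (2 * j + 1) * Nat.centralBinom j := by
      exact_mod_cast Nat.succ_mul_centralBinom_succ j
    rw [show 2 * (j + 1) = 2 * j + 2 by ring, integral_sin_pow, ih]
    simp only [Real.sin_zero, Real.cos_pi_div_two, mul_zero, sub_zero]
    rw [pow_succ]
    push_cast
    field_simp
    linear_combination (-2 * Real.pi * 4 ^ j) * hcb

theorem integral_cos_sq_mul_sin_pow (j : ℕ) :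
    ∫ t in (0 : ℝ)..(Real.pi / 2), Real.cos t ^ 2 * Real.sin t ^ (2 * j)
      = Real.pi / 4 * (Nat.centralBinom j / 4 ^ j / (j + 1)) := by
  have h : ∀ t, Real.cos t ^ 2 * Real.sin t ^ (2 * j)
      = Real.sin t ^ (2 * j) - Real.sin t ^ (2 * (j + 1)) := fun t => by
    rw [Real.cos_sq', mul_add, pow_add]; ring
  have hcb : ((j : ℝ) + 1) * Nat.centralBinom (j + 1)
      = 2 * (2 * j + 1) * Nat.centralBinom j := by
    exact_mod_cast Nat.succ_mul_centralBinom_succ j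
  simp only [h]
  rw [intervalIntegral.integral_sub (Continuous.intervalIntegrable (by fun_prop) _ _)
    (Continuous.intervalIntegrable (by fun_prop) _ _), integral_sin_pow_even_pi_div_two,
    integral_sin_pow_even_pi_div_two, pow_succ]
  field_simp
  linear_combination -hcb

/-- Expand `1 / √(1 - v)` at `v = x² sin² t` and integrate termwise by Wallis' formulas. The
variable `x² / 16` absorbs the two factors `4 ^ j`, leaving integer coefficients. -/
theorem realHaagerup_sub_isBigO :
    (fun x : ℝ => realHaagerup x - Real.pi / 4 * x * haagerupPoly.eval (x ^ 2 / 16))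
      =O[𝓝 0] fun x => x ^ 21 := by
  obtain ⟨M, hM⟩ := (one_div_sqrt_one_sub_isBigO 10).bound
  obtain ⟨ε, hε, hball⟩ := Metric.eventually_nhds_iff.1 hM
  have hsq : Tendsto (fun x : ℝ => x ^ 2) (𝓝 0) (𝓝 0) := by
    simpa using (continuous_pow 2).tendsto (0 : ℝ)
  refine IsBigO.of_bound (M * (Real.pi / 2)) ?_
  filter_upwards [hsq.eventually (gt_mem_nhds hε), Metric.ball_mem_nhds (0 : ℝ) one_pos]
    with x hx hx1
  have hx1' : |x| ≤ 1 := by rw [mem_ball_zero_iff] at hx1; exact hx1.le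
  have hp : haagerupPoly.eval (x ^ 2 / 16) * (Real.pi / 4)
      = ∫ t in (0 : ℝ)..(Real.pi / 2), Real.cos t ^ 2 * ∑ j ∈ Finset.range 10,
        (Nat.centralBinom j : ℝ) / 4 ^ j * (x ^ 2 * Real.sin t ^ 2) ^ j := by
    simp only [Finset.mul_sum]
    rw [intervalIntegral.integral_finsetSum fun j _ =>
      Continuous.intervalIntegrable (by fun_prop) _ _]
    simp only [haagerupPoly, Polynomial.eval_finsetSum, Polynomial.eval_mul, Polynomial.eval_C,
      Polynomial.eval_pow, Polynomial.eval_X, Finset.sum_mul]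
    refine Finset.sum_congr rfl fun j hj => ?_
    have e : ∀ t, Real.cos t ^ 2 * ((Nat.centralBinom j : ℝ) / 4 ^ j
        * (x ^ 2 * Real.sin t ^ 2) ^ j) = (Nat.centralBinom j : ℝ) / 4 ^ j * (x ^ 2) ^ j
          * (Real.cos t ^ 2 * Real.sin t ^ (2 * j)) := fun t => by
      rw [mul_pow, ← pow_mul (Real.sin t)]; ring
    simp only [e]
    rw [intervalIntegral.integral_const_mul, integral_cos_sq_mul_sin_pow,
      haagerupCoeff_eq (Finset.mem_range.1 hj), div_pow,
      show (16 : ℝ) ^ j = 4 ^ j * 4 ^ j by rw [← mul_pow]; norm_num]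
    field_simp
  have hdiff : realHaagerup x - Real.pi / 4 * x * haagerupPoly.eval (x ^ 2 / 16)
      = x * ∫ t in (0 : ℝ)..(Real.pi / 2), Real.cos t ^ 2 * (1 / Real.sqrt (1 - x ^ 2
        * Real.sin t ^ 2) - ∑ j ∈ Finset.range 10,
        (Nat.centralBinom j : ℝ) / 4 ^ j * (x ^ 2 * Real.sin t ^ 2) ^ j) := by
    simp only [mul_sub, mul_one_div]
    rw [intervalIntegral.integral_sub (intervalIntegrable_realHaagerup hx1')
      (Continuous.intervalIntegrable (by fun_prop) _ _), ← hp, realHaagerup]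
    ring
  rw [hdiff, norm_mul]
  have hbound : ‖∫ t in (0 : ℝ)..(Real.pi / 2), Real.cos t ^ 2 * (1 / Real.sqrt (1 - x ^ 2
        * Real.sin t ^ 2) - ∑ j ∈ Finset.range 10,
        (Nat.centralBinom j : ℝ) / 4 ^ j * (x ^ 2 * Real.sin t ^ 2) ^ j)‖
      ≤ M * |x| ^ 20 * |Real.pi / 2 - 0| := by
    refine intervalIntegral.norm_integral_le_of_norm_le_const fun t _ => ?_
    have hs := Real.sin_sq_le_one t
    have hv0 : 0 ≤ x ^ 2 * Real.sin t ^ 2 := by positivity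
    have hv1 : x ^ 2 * Real.sin t ^ 2 ≤ x ^ 2 := mul_le_of_le_one_right (sq_nonneg x) hs
    have h1 := hball (y := x ^ 2 * Real.sin t ^ 2) (by
      rw [Real.dist_0_eq_abs, abs_of_nonneg hv0]; linarith)
    rw [norm_mul, norm_pow]
    have h2 : ‖Real.cos t‖ ^ 2 ≤ 1 := pow_le_one₀ (norm_nonneg _) (Real.abs_cos_le_one t)
    have hM0 : 0 ≤ M := by
      by_contra hneg
      have h3 := hball (y := ε / 2) (by rw [Real.dist_0_eq_abs, abs_of_pos] <;> linarith)
      have h4 : 0 < ‖(ε / 2) ^ 10‖ := norm_pos_iff.2 (by positivity)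
      have h5 := (norm_nonneg _).trans h3
      nlinarith
    refine (mul_le_of_le_one_left (norm_nonneg _) h2).trans (h1.trans ?_)
    refine mul_le_mul_of_nonneg_left ?_ hM0
    rw [norm_pow, Real.norm_of_nonneg hv0, show |x| ^ 20 = (x ^ 2) ^ 10 by
      rw [← sq_abs x, ← pow_mul]]
    gcongr
  refine (mul_le_mul_of_nonneg_left hbound (norm_nonneg x)).trans (le_of_eq ?_)
  rw [sub_zero, abs_of_pos Real.pi_div_two_pos, norm_pow, Real.norm_eq_abs]
  ring

end lowOrder

/-! ### The triangular system and the signs for small index. -/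

section lowOrderSign
open Asymptotics

theorem Asymptotics.IsBigO.pow_sub_pow {l : Filter ℝ} {f g e : ℝ → ℝ}
    (h : (fun x => f x - g x) =O[l] e) (hf : f =O[l] fun _ => (1 : ℝ))
    (hg : g =O[l] fun _ => (1 : ℝ)) (n : ℕ) : (fun x => f x ^ n - g x ^ n) =O[l] e := by
  induction n with
  | zero => simpa using isBigO_zero e l
  | succ n ih =>
    have h1 : (fun x => f x ^ n * (f x - g x)) =O[l] fun x => 1 ^ n * e x := (hf.pow n).mul h
    have h2 : (fun x => (f x ^ n - g x ^ n) * g x) =O[l] fun x => e x * 1 := ih.mul hg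
    simp only [one_pow, one_mul, mul_one] at h1 h2
    refine (h1.add h2).congr_left fun x => ?_
    ring

variable {b : ℕ → ℝ}

theorem IsHaagerupInvExpansion.sub_sum_isBigO (hb : IsHaagerupInvExpansion b) :
    (fun x : ℝ => x - ∑ j ∈ Finset.range 10, b j * realHaagerup x ^ (2 * j + 1))
      =O[𝓝[>] 0] fun x => realHaagerup x ^ 21 := by
  obtain ⟨r, hr, hev⟩ := hb.exists_remainder 9
  have harc : Tendsto (fun x : ℝ => (Real.arcsin x : ℂ)) (𝓝[>] 0) (𝓝 0) := by
    have : Continuous fun x : ℝ => (Real.arcsin x : ℂ) :=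
      Complex.continuous_ofReal.comp Real.continuous_arcsin
    simpa using (this.tendsto 0).mono_left nhdsWithin_le_nhds
  have hlift : ∀ᶠ x : ℝ in 𝓝[>] 0, haagerupLift (Real.arcsin x) = realHaagerup x := by
    filter_upwards [Ioo_mem_nhdsGT one_pos] with x hx
    have h1 : Real.arcsin x < Real.pi / 2 := Real.arcsin_lt_pi_div_two.2 hx.2
    rw [haagerupLift_ofReal_eq_realHaagerup (Real.arcsin_pos.2 hx.1) h1,
      Real.sin_arcsin (by linarith [hx.1]) hx.2.le]
  have hGc : Tendsto haagerupLift (𝓝 0) (𝓝 0) := by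
    have : AnalyticAt ℂ haagerupLift 0 :=
      analyticAt_haagerupLift (by simpa using Real.pi_div_two_pos)
    simpa using this.continuousAt.tendsto
  have hrO : (fun x : ℝ => r (haagerupLift (Real.arcsin x))) =O[𝓝[>] 0] fun _ => (1 : ℝ) :=
    (hr.continuousAt.tendsto.comp (hGc.comp harc)).isBigO_one ℝ
  have hGO : (fun x : ℝ => haagerupLift (Real.arcsin x) ^ 21) =O[𝓝[>] 0]
      fun x => realHaagerup x ^ 21 := by
    refine IsBigO.of_bound 1 ?_
    filter_upwards [hlift] with x hx
    rw [hx, one_mul, norm_pow, norm_pow, Complex.norm_real]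
  have hmul := hGO.mul hrO
  simp only [mul_one] at hmul
  refine IsBigO.trans (IsBigO.of_bound 1 ?_) hmul
  filter_upwards [harc.eventually hev, hlift, Ioo_mem_nhdsGT one_pos] with x hx hl hx1
  rw [hl, ← Complex.ofReal_sin, Real.sin_arcsin (by linarith [hx1.1]) hx1.2.le] at hx
  rw [hl, one_mul, ← hx, ← Complex.norm_real]
  push_cast
  rfl

theorem haagerupInv_system (hb : IsHaagerupInvExpansion b) : ∀ m < 10,
    ∑ k ∈ Finset.range (m + 1), b k * (Real.pi / 4) ^ (2 * k + 1) * 16 ^ k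
      * (haagerupPowCoeff (2 * k + 1) (m - k) : ℝ) = if m = 0 then 1 else 0 := by
  set g : ℝ → ℝ := fun x => Real.pi / 4 * x * haagerupPoly.eval (x ^ 2 / 16) with hg
  have hgc : Continuous g := by
    have := haagerupPoly.continuous
    fun_prop
  have hhg : (fun x => realHaagerup x - g x) =O[𝓝[>] 0] fun x => x ^ 21 :=
    realHaagerup_sub_isBigO.mono nhdsWithin_le_nhds
  have hid : Tendsto (fun x : ℝ => x) (𝓝[>] 0) (𝓝 0) := nhdsWithin_le_nhds
  have hidO : (fun x : ℝ => x) =O[𝓝[>] 0] fun _ => (1 : ℝ) := hid.isBigO_one ℝ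
  have hgx : g =O[𝓝[>] 0] fun x => x := by
    have h1 : Continuous fun x : ℝ => Real.pi / 4 * haagerupPoly.eval (x ^ 2 / 16) := by
      have := haagerupPoly.continuous
      fun_prop
    have h2 := (((h1.tendsto 0).mono_left (nhdsWithin_le_nhds (s := Ioi 0))).isBigO_one ℝ).mul
      (isBigO_refl (fun x : ℝ => x) (𝓝[>] 0))
    simp only [one_mul] at h2
    refine h2.congr_left fun x => ?_
    simp only [hg]; ring
  have hx21 : (fun x : ℝ => x ^ 21) =O[𝓝[>] 0] fun x => x := by
    have := (hidO.pow 20).mul (isBigO_refl (fun x : ℝ => x) (𝓝[>] 0))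
    simp only [one_pow, one_mul] at this
    exact this.congr_left fun x => by ring
  have hhx : realHaagerup =O[𝓝[>] 0] fun x => x :=
    ((hhg.trans hx21).add hgx).congr_left fun x => by ring
  have hsum : (fun x => ∑ j ∈ Finset.range 10, b j * (realHaagerup x ^ (2 * j + 1)
      - g x ^ (2 * j + 1))) =O[𝓝[>] 0] fun x => x ^ 21 :=
    IsBigO.fun_sum fun j _ =>
      (hhg.pow_sub_pow (hhx.trans hidO) (hgx.trans hidO) (2 * j + 1)).const_mul_left (b j)
  have hmain := (hb.sub_sum_isBigO.trans (hhx.pow 21)).add hsum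
  -- With `w = x² / 16`, `Q` is what remains of `x - ∑ b_j h(x)^(2j+1)` after replacing `h` by its
  -- Taylor polynomial and dividing by `x`. It is `O(w^10)`, so its first ten coefficients vanish,
  -- which is the system.
  set Q : Polynomial ℝ := 1 - ∑ k ∈ Finset.range 10,
    Polynomial.C (b k * (Real.pi / 4) ^ (2 * k + 1) * 16 ^ k)
      * (Polynomial.X ^ k * haagerupPoly ^ (2 * k + 1)) with hQ
  have hQeval : ∀ x : ℝ, x * Q.eval (x ^ 2 / 16)
      = x - ∑ j ∈ Finset.range 10, b j * g x ^ (2 * j + 1) := fun x => by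
    simp only [hQ, Polynomial.eval_sub, Polynomial.eval_one, Polynomial.eval_finsetSum,
      Polynomial.eval_mul, Polynomial.eval_C, Polynomial.eval_pow, Polynomial.eval_X, mul_sub,
      mul_one, Finset.mul_sum, hg]
    congr 1
    refine Finset.sum_congr rfl fun j _ => ?_
    generalize haagerupPoly.eval (x ^ 2 / 16) = P
    have e : (x ^ 2 / 16) ^ j * 16 ^ j = x ^ (2 * j) := by
      rw [← mul_pow, div_mul_cancel₀ _ (by norm_num), ← pow_mul]
    rw [mul_pow (Real.pi / 4 * x), mul_pow (Real.pi / 4), pow_succ x (2 * j), ← e]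
    ring
  have hQx : (fun x : ℝ => Q.eval (x ^ 2 / 16)) =O[𝓝[>] 0] fun x => x ^ 20 := by
    have h1 := hmain.mul (isBigO_refl (fun x : ℝ => x⁻¹) (𝓝[>] 0))
    refine h1.congr' ?_ ?_ <;> filter_upwards [self_mem_nhdsWithin] with x hx
    · have hx0 : x ≠ 0 := ne_of_gt hx
      have h2 := hQeval x
      simp only [mul_sub, Finset.sum_sub_distrib]
      rw [← div_eq_mul_inv, div_eq_iff hx0, mul_comm _ x, h2]
      ring
    · have hx0 : x ≠ 0 := ne_of_gt hx
      field_simp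
  -- Inverse of `w = x² / 16` on the positive side.
  have hsqrt : Tendsto (fun w : ℝ => 4 * Real.sqrt w) (𝓝[>] 0) (𝓝[>] 0) := by
    refine tendsto_nhdsWithin_iff.2 ⟨?_, ?_⟩
    · have : Continuous fun w : ℝ => 4 * Real.sqrt w := by fun_prop
      simpa using (this.tendsto 0).mono_left (nhdsWithin_le_nhds (s := Ioi 0))
    · filter_upwards [self_mem_nhdsWithin] with w hw
      exact mul_pos four_pos (Real.sqrt_pos.2 hw)
  have hQw : (fun w : ℝ => Q.eval w) =O[𝓝[>] 0] fun w => w ^ 10 := by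
    refine IsBigO.trans ((hQx.comp_tendsto hsqrt).congr' ?_ EventuallyEq.rfl) ?_
    · filter_upwards [self_mem_nhdsWithin] with w hw
      simp only [Function.comp]
      rw [mul_pow, Real.sq_sqrt (le_of_lt hw)]
      congr 1; ring
    · refine IsBigO.of_bound (4 ^ 20) ?_
      filter_upwards [self_mem_nhdsWithin] with w hw
      simp only [Function.comp]
      rw [mul_pow, show Real.sqrt w ^ 20 = (Real.sqrt w ^ 2) ^ 10 by ring,
        Real.sq_sqrt (le_of_lt hw), norm_mul]
      simp
  intro m hm
  have hcoeff := Polynomial.coeff_eq_zero_of_isBigO hQw m hm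
  rw [hQ, Polynomial.coeff_sub, Polynomial.finsetSum_coeff, sub_eq_zero, Polynomial.coeff_one]
    at hcoeff
  rw [hcoeff]
  have hsub : Finset.range (m + 1) ⊆ Finset.range 10 := Finset.range_subset_range.2 hm
  rw [← Finset.sum_subset hsub]
  · refine Finset.sum_congr rfl fun k hk => ?_
    have hk' := Finset.mem_range.1 hk
    rw [Polynomial.coeff_C_mul, Polynomial.coeff_X_pow_mul', if_pos (by omega),
      coeff_haagerupPoly_pow _ _ (by omega)]
  · intro k _ hk
    rw [Finset.mem_range, not_lt] at hk
    rw [Polynomial.coeff_C_mul, Polynomial.coeff_X_pow_mul', if_neg (by omega), mul_zero]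

theorem coefficient_nonpos_of_lt_ten (hb : IsHaagerupInvExpansion b) {k : ℕ} (hk : k < 10)
    (hk1 : 1 ≤ k) : b k ≤ 0 := by
  have h1 := eq_haagerupInvCoeff_of_system (haagerupInv_system hb) k hk
  have h2 : (haagerupInvCoeff k : ℝ) ≤ 0 := by exact_mod_cast haagerupInvCoeff_nonpos k hk hk1
  rw [← h1, mul_assoc] at h2
  have h3 : 0 < (Real.pi / 4) ^ (2 * k + 1) * (16 : ℝ) ^ k := by
    have := Real.pi_pos
    positivity
  exact nonpos_of_mul_nonpos_left h2 h3

end lowOrderSign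

/-! ### Existence of the expansion. -/

section existence

/-- The bounds `|h x| ≥ (π/4) |x|` and `sin s ≥ 2s/π` give `|G s| ≥ s / 2` for small `s > 0`, which
a vanishing derivative would contradict. -/
theorem deriv_haagerupLift_zero_ne_zero : deriv haagerupLift 0 ≠ 0 := by
  intro h0
  have hd : HasDerivAt haagerupLift 0 0 := by
    have := (differentiableAt_haagerupLift (z := 0)
      (by simpa using Real.pi_div_two_pos)).hasDerivAt
    rwa [h0] at this
  have h1 := (hasDerivAt_iff_isLittleO.1 hd).bound (show (0 : ℝ) < 1 / 4 by norm_num)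
  have hreal : Tendsto (fun s : ℝ => (s : ℂ)) (𝓝[>] 0) (𝓝 0) := by
    simpa using (Complex.continuous_ofReal.tendsto 0).mono_left nhdsWithin_le_nhds
  obtain ⟨s, hs1, hs⟩ := ((hreal.eventually h1).and
    (Ioo_mem_nhdsGT Real.pi_div_two_pos)).exists
  simp only [haagerupLift_zero, sub_zero, smul_zero] at hs1
  rw [haagerupLift_ofReal_eq_realHaagerup hs.1 hs.2, Complex.norm_real, Complex.norm_real,
    Real.norm_eq_abs, Real.norm_of_nonneg hs.1.le] at hs1
  have h2 := mul_abs_le_abs_realHaagerup (Real.abs_sin_le_one s)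
  have h3 := Real.mul_abs_le_abs_sin (x := s) (by rw [abs_of_pos hs.1]; exact hs.2.le)
  rw [abs_of_pos hs.1] at h3
  have h4 : Real.pi / 4 * (2 / Real.pi * s) ≤ Real.pi / 4 * |Real.sin s| :=
    mul_le_mul_of_nonneg_left h3 (by positivity)
  have h5 : Real.pi / 4 * (2 / Real.pi * s) = s / 2 := by
    have := Real.pi_ne_zero
    field_simp; norm_num
  linarith [hs.1]

theorem tendsto_realHaagerupInv : Tendsto realHaagerupInv (𝓝 0) (𝓝 0) := by
  have hlim : Tendsto (fun y : ℝ => 4 / Real.pi * |y|) (𝓝 0) (𝓝 0) := by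
    have : Continuous fun y : ℝ => 4 / Real.pi * |y| := by fun_prop
    simpa using this.tendsto 0
  refine squeeze_zero_norm' ?_ hlim
  filter_upwards [Icc_mem_nhds (show (-1 : ℝ) < 0 by norm_num) one_pos] with y hy
  have h1 := mul_abs_le_abs_realHaagerup (abs_le.2 (realHaagerupInv_mem hy))
  rw [realHaagerup_realHaagerupInv hy] at h1
  rw [Real.norm_eq_abs, div_mul_eq_mul_div, le_div_iff₀ Real.pi_pos]
  linarith

/-- If `ψ` is the local inverse of the lift, the inverse function is `sin ∘ ψ`. The a priori bound
`|h⁻¹ y| ≤ (4/π) |y|` places `arcsin (h⁻¹ y)` in the domain where `ψ` inverts the lift. -/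
theorem exists_analyticAt_eq_realHaagerupInv : ∃ f : ℂ → ℂ, AnalyticAt ℂ f 0 ∧
    ∀ᶠ y : ℝ in 𝓝 0, f y = realHaagerupInv y := by
  have hG : AnalyticAt ℂ haagerupLift 0 :=
    analyticAt_haagerupLift (by simpa using Real.pi_div_two_pos)
  set ψ := hG.hasStrictDerivAt.localInverse _ _ _ deriv_haagerupLift_zero_ne_zero with hψ
  have hψa : AnalyticAt ℂ ψ 0 := by
    have := hG.analyticAt_localInverse deriv_haagerupLift_zero_ne_zero
    rwa [haagerupLift_zero] at this
  have hleft : ∀ᶠ z in 𝓝 0, ψ (haagerupLift z) = z :=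
    hG.hasStrictDerivAt.eventually_left_inverse (deriv_haagerupLift_zero_ne_zero)
  refine ⟨fun w => Complex.sin (ψ w), Complex.analyticAt_sin.comp hψa, ?_⟩
  have hs : Tendsto (fun y : ℝ => Real.arcsin (realHaagerupInv y)) (𝓝 0) (𝓝 0) := by
    have h := (Real.continuous_arcsin.tendsto 0).comp tendsto_realHaagerupInv
    rwa [Real.arcsin_zero] at h
  have hsc : Tendsto (fun y : ℝ => (Real.arcsin (realHaagerupInv y) : ℂ)) (𝓝 0) (𝓝 0) := by
    have h := (Complex.continuous_ofReal.tendsto 0).comp hs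
    rwa [Complex.ofReal_zero] at h
  have habs : Tendsto (fun y : ℝ => |Real.arcsin (realHaagerupInv y)|) (𝓝 0) (𝓝 0) := by
    simpa using hs.abs
  filter_upwards [hsc.eventually hleft, habs.eventually (gt_mem_nhds Real.pi_div_two_pos),
    Icc_mem_nhds (show (-1 : ℝ) < 0 by norm_num) one_pos] with y hy1 hy2 hy
  have hm := realHaagerupInv_mem hy
  rw [haagerupLift_ofReal_eq hy2, Real.sin_arcsin hm.1 hm.2, realHaagerup_realHaagerupInv hy]
    at hy1
  rw [hy1, ← Complex.ofReal_sin, Real.sin_arcsin hm.1 hm.2]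

theorem exists_isHaagerupInvExpansion : ∃ b : ℕ → ℝ, IsHaagerupInvExpansion b := by
  obtain ⟨f, ⟨p, hp⟩, hf⟩ := exists_analyticAt_eq_realHaagerupInv
  have hsum := hasFPowerSeriesAt_iff.1 hp
  have hreal : Tendsto (fun y : ℝ => (y : ℂ)) (𝓝 0) (𝓝 0) := by
    simpa using Complex.continuous_ofReal.tendsto 0
  have hre : ∀ᶠ y : ℝ in 𝓝 0, HasSum (fun n => (p.coeff n).re * y ^ n) (realHaagerupInv y) := by
    filter_upwards [hreal.eventually hsum, hf] with y hy hfy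
    rw [zero_add, hfy] at hy
    have := Complex.hasSum_re hy
    rw [Complex.ofReal_re] at this
    refine this.congr_fun fun n => ?_
    rw [smul_eq_mul, ← Complex.ofReal_pow, Complex.re_ofReal_mul, mul_comm]
  have hneg : Tendsto (fun y : ℝ => -y) (𝓝 0) (𝓝 0) := by
    simpa using (continuous_neg (G := ℝ)).tendsto 0
  refine ⟨fun k => (p.coeff (2 * k + 1)).re, ?_⟩
  filter_upwards [hre, hneg.eventually hre,
    Icc_mem_nhds (show (-1 : ℝ) < 0 by norm_num) one_pos] with y h1 h2 hy
  rw [realHaagerupInv_neg hy] at h2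
  -- Oddness of the inverse: half the difference of the series at `y` and `-y` removes the even
  -- terms.
  have h3 := (h1.sub h2).div_const 2
  have h4 : (realHaagerupInv y - -realHaagerupInv y) / 2 = realHaagerupInv y := by ring
  rw [h4] at h3
  have hinj : Function.Injective fun k : ℕ => 2 * k + 1 := fun a c h => by
    simp only at h; omega
  rw [← hinj.hasSum_iff] at h3
  · refine h3.congr_fun fun k => ?_
    simp only [Function.comp]
    rw [Odd.neg_pow ⟨k, rfl⟩]; ring
  · intro n hn
    have heven : Even n := by
      by_contra ho
      obtain ⟨k, hk⟩ := Nat.not_even_iff_odd.1 ho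
      exact hn ⟨k, hk.symm⟩
    rw [heven.neg_pow]; ring

end existence

theorem mainTheorem2 :
    BijOn realHaagerup (Icc (-1) 1) (Icc (-1) 1) ∧
    (∃ b : ℕ → ℝ, IsHaagerupInvExpansion b) ∧
    ∀ b : ℕ → ℝ, IsHaagerupInvExpansion b → ∀ k : ℕ, 1 ≤ k → b k ≤ 0 := by
  refine ⟨bijOn_realHaagerup, exists_isHaagerupInvExpansion, fun b hb k hk => ?_⟩
  rcases lt_or_ge k 10 with h | h
  · exact coefficient_nonpos_of_lt_ten hb h hk
  · exact coefficient_nonpos_of_ten_le hb h
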